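/- **Theorem (Token Accelerated Variance-Reduced).** Let $n,m,K,d$ be integers with $m\ge 1$ and $1\le K\le n$, let $\sigma>0$, and for $i\in[n]$, $j\in[m]$ let $f_{ij}:\mathbb R^d\to\mathbb R$ be convex and $L_{ij}$-smooth ($L_{ij}>0$). Let $\theta_\star$ be the minimizer of $\sum_{i=1}^n\big[\sum_{j=1}^m f_{ij}(\theta)+\frac{\sigma}{2}\|\theta\|^2\big]$. Put $$\tilde\sigma=\frac{n\sigma}{n+K},\qquad \kappa_s=\max_i\Big(1+\sum_{j=1}^m \frac{L_{ij}}{\tilde\sigma}\Big),\qquad \alpha=\frac{2K}{\tilde\sigma\kappa_s}.$$ (Since $\tilde\sigma\ge\sigma/2$, one has $\kappa_s\le 2\max_i\sum_{j}(1+L_{ij}/\sigma)$.) *Conceptual graph and dual.* The vertices are the nodes $i\in[n]$, the tokens $k\in[K]$, and the computation vertices $(i,j)$. The edges are the communication edges between $i$ and $k$, with weight $\mu_{ik}=1$, and the computation edges between $(i,j)$ and $i$, with weight $\mu_{ij}=\sqrt{\alpha L_{ij}}$. Let $A$ be the weighted incidence matrix, $Ae_{uv}=\mu_{uv}(e_u-e_v)$,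 with computation edges oriented from $(i,j)$ to $i$, and let $\Sigma$ be the diagonal matrix with entries $L_{ij}$ at $(i,j)$ and $\tilde\sigma$ at nodes and tokens. The dual problem is to minimize over $\lambda$ (one block in $\mathbb R^d$ per edge) the function $q(\lambda)+\sum_e\psi_e(\lambda_e)$, where $q(\lambda)=\frac12\lambda^\top A^\top\Sigma^{-1}A\lambda$, $\psi_{ik}=0$ and $\psi_{ij}(u)=f_{ij}^*(\mu_{ij}u)-\frac{\mu_{ij}^2}{2L_{ij}}\|u\|^2$. *Algorithm (Accelerated TVR: accelerated proximal coordinate gradient on the dual).* At each iteration an edge $e$ is drawn independently with probability $p_e$, where $p_{ik}=\frac{p_{\rm comm}}{nK}$, $p_{ij}=\frac{p_{\rm comp}}{n}\frac{\sqrt{1+L_{ij}/\tilde\sigma}}{\sum_{j'}\sqrt{1+L_{ij'}/\tilde\sigma}}$, $p_{\rm comm}+p_{\rm comp}=1$ and $\frac{p_{\rm comm}}{p_{\rm comp}}=\frac{\sqrt{2\kappa_s}}{m+\sqrt{m\kappa_s}}$. With $\sigma_A=\lambda^+_{\min}(A^\top\Sigma^{-1}A)$ (smallest positive eigenvalue),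 $R_e=(A^\dagger A)_{ee}$ and $\rho^2=\min_{e=(u,v)}\frac{\sigma_A}{\Sigma_{uu}^{-1}+\Sigma_{vv}^{-1}}\frac{p_e^2}{\mu_e^2R_e}$, the iteration is $$y_t=\frac{x_t+\rho v_t}{1+\rho},\quad w_t=(1-\rho)v_t+\rho y_t,\quad v_{t+1}^{(e)}=\arg\min_u\Big\{\tfrac12\|u-w_t^{(e)}\|^2+\tfrac{\rho}{\sigma_Ap_e}\big(\langle\nabla_eq(y_t),u\rangle+\psi_e(u)\big)\Big\},$$ $v_{t+1}^{(e')}=w_t^{(e')}$ for $e'\neq e$, and $x_{t+1}=y_t+\frac{\rho R_e}{p_e}(v_{t+1}-w_t)$. It starts from $x_0=v_0$ with zero communication blocks and computation blocks $u_{ij}/\mu_{ij}$, where the $u_{ij}$ are arbitrary points with $f_{ij}^*(u_{ij})<\infty$ (for example $u_{ij}=\nabla f_{ij}(z_{ij})$). Token $k$ holds $\theta_t^{{\rm token},k}=\tilde\sigma^{-1}(Av_t)_k$. Drawing an edge $(i,j)$ is one computation step of node $i$; drawing an edge $(i,k)$ is one jump of token $k$, to node $i$. *Claim.* There is a universal constant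 $C>0$ (independent of $n,m,K,d$ and of the problem) such that, for every such problem and starting point, there is $C_0>0$, depending on the problem, $K$ and the starting point but not on $\varepsilon$, with the following property. For every $\varepsilon>0$ there is a number of iterations $T$ such that $\mathbb E\|\theta_t^{{\rm token},k}-\theta_\star\|^2\le\varepsilon$ for all $t\ge T$ and all $k\in[K]$, while during the first $T$ iterations the expected number of computation steps of each node and the expected number of jumps of each token are respectively at most $$T_{\rm comp}\le C\,(m+\sqrt{m\kappa_s})\,\log(1+C_0/\varepsilon),\qquad T_{\rm comm}\le C\,\frac nK\sqrt{\kappa_s}\,\log(1+C_0/\varepsilon),$$ that is, $O((m+\sqrt{m\kappa_s})\log\varepsilon^{-1})$ and $O(\frac nK\sqrt{\kappa_s}\log\varepsilon^{-1})$. -/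

import Mathlib

open scoped BigOperators

noncomputable section

namespace TAVR

/-- The parameter space `ℝ^d` with its Euclidean norm. -/
abbrev Vec (d : ℕ) : Type := EuclideanSpace ℝ (Fin d)

/-- A finite-sum problem over `n` nodes with `m` local functions per node: each `f i j` is convex
and `L i j`-smooth on `ℝ^d`, and `σ > 0` is the regularization parameter. -/
structure Problem (n m d : ℕ) where
  f : Fin n → Fin m → Vec d → ℝ
  L : Fin n → Fin m → ℝ
  σ : ℝ
  σ_pos : 0 < σ
  L_pos : ∀ i j, 0 < L i j
  convex : ∀ i j, ConvexOn ℝ Set.univ (f i j)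
  differentiable : ∀ i j, Differentiable ℝ (f i j)
  smooth : ∀ i j x y, ‖gradient (f i j) x - gradient (f i j) y‖ ≤ L i j * ‖x - y‖

/-- Vertices of the conceptual graph: one computation vertex `(i, j)` for each `f i j`,
one communication vertex for each node `i`, one vertex for each token `k`. -/
abbrev Vertex (n m K : ℕ) : Type := (Fin n × Fin m) ⊕ (Fin n ⊕ Fin K)

/-- Edges of the conceptual graph: the communication edges `(i, k)` between node `i` and token `k`,
and the computation edges `(i, j)` between computation vertex `(i, j)` and node `i`. -/
abbrev Edge (n m K : ℕ) : Type := (Fin n × Fin K) ⊕ (Fin n × Fin m)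

namespace Vertex

variable {n m K : ℕ}

def comp (i : Fin n) (j : Fin m) : Vertex n m K := Sum.inl (i, j)
def node (i : Fin n) : Vertex n m K := Sum.inr (Sum.inl i)
def token (k : Fin K) : Vertex n m K := Sum.inr (Sum.inr k)

end Vertex

namespace Edge

variable {n m K : ℕ}

/-- First endpoint (for the arbitrary orientation that is used). -/
def src : Edge n m K → Vertex n m K
  | Sum.inl (i, _) => Vertex.node i
  | Sum.inr (i, j) => Vertex.comp i j

/-- Second endpoint. -/
def dst : Edge n m K → Vertex n m K
  | Sum.inl (_, k) => Vertex.token k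
  | Sum.inr (i, _) => Vertex.node i

/-- The edge is a computation edge of node `i`, i.e. sampling it is a computation step of node `i`
(one proximal step on some `f i j`). -/
def isCompOf (i : Fin n) : Edge n m K → Bool
  | Sum.inl _ => false
  | Sum.inr (i', _) => decide (i' = i)

/-- The edge is a communication edge of token `k`, i.e. sampling it is a jump of token `k`. -/
def isJumpOf (k : Fin K) : Edge n m K → Bool
  | Sum.inl (_, k') => decide (k' = k)
  | Sum.inr _ => false

end Edge

/-- The smallest positive eigenvalue of a square real matrix. -/
def lambdaMinPos {ι : Type*} [Fintype ι] [DecidableEq ι] (M : Matrix ι ι ℝ) : ℝ :=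
  sInf {t : ℝ | 0 < t ∧ Module.End.HasEigenvalue (Matrix.toLin' M) t}

/-- The diagonal entry `(A† A)_{ee}`, where `A† A` is the orthogonal projection
onto the orthogonal complement of the kernel of `A`. -/
def pinvDiag {ι κ : Type*} [Fintype ι] [DecidableEq ι] [Fintype κ] [DecidableEq κ]
    (A : Matrix κ ι ℝ) (e : ι) : ℝ :=
  inner ℝ (EuclideanSpace.single e (1 : ℝ))
    ((LinearMap.ker (Matrix.toEuclideanLin A))ᗮ.starProjection (EuclideanSpace.single e (1 : ℝ)))

/-- The Fenchel conjugate `g*(u) = sup_θ ⟨u, θ⟩ - g(θ)`, with values in `[-∞, +∞]`. -/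
def conj {d : ℕ} (g : Vec d → ℝ) (u : Vec d) : EReal :=
  ⨆ θ : Vec d, ((inner ℝ u θ - g θ : ℝ) : EReal)

open Classical in
/-- A minimizer of an extended-real-valued function (arbitrary if there is none). -/
def argmin {X : Type*} [Nonempty X] (F : X → EReal) : X :=
  Classical.epsilon fun u => ∀ u', F u ≤ F u'

namespace Problem

variable {n m d : ℕ} (P : Problem n m d) (K : ℕ)

/-- The primal objective `∑_i (f_i(θ) + (σ/2) ‖θ‖²)`, with `f_i = ∑_j f_{ij}`. -/
def objective (θ : Vec d) : ℝ :=
  ∑ i : Fin n, ((∑ j : Fin m, P.f i j θ) + P.σ / 2 * ‖θ‖ ^ 2)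

/-- `σ̃ = n σ / (n + K)`. -/
def sigmaT : ℝ := n * P.σ / (n + K)

/-- `κ_s = max_i (1 + ∑_j L_{ij} / σ̃)`. -/
def kappaS : ℝ := ⨆ i : Fin n, (1 + ∑ j : Fin m, P.L i j / P.sigmaT K)

/-- `α = 2 K / (σ̃ κ_s)`. -/
def alpha : ℝ := 2 * K / (P.sigmaT K * P.kappaS K)

/-- Edge weights: `1` for communication edges, `√(α L_{ij})` for computation edges. -/
def weight : Edge n m K → ℝ
  | Sum.inl _ => 1
  | Sum.inr (i, j) => √(P.alpha K * P.L i j)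

/-- Diagonal of `Σ`: `L_{ij}` at computation vertices, `σ̃` at nodes and tokens. -/
def Sig : Vertex n m K → ℝ
  | Sum.inl (i, j) => P.L i j
  | Sum.inr _ => P.sigmaT K

/-- The weighted incidence matrix of the conceptual graph: `A e_{uv} = μ_{uv} (e_u - e_v)`. -/
def incidence : Matrix (Vertex n m K) (Edge n m K) ℝ := fun v e =>
  P.weight K e * ((if v = e.src then 1 else 0) - (if v = e.dst then 1 else 0))

/-- `Aᵀ Σ⁻¹ A`, the Hessian of the quadratic part `q(λ) = (1/2) λᵀ Aᵀ Σ⁻¹ A λ` of the dual. -/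
def hessian : Matrix (Edge n m K) (Edge n m K) ℝ :=
  (P.incidence K).transpose * Matrix.diagonal (fun v => (P.Sig K v)⁻¹) * P.incidence K

/-- The strong convexity constant `σ_A = λ_min⁺(Aᵀ Σ⁻¹ A)`. -/
def sigmaA : ℝ := lambdaMinPos (P.hessian K)

/-- `R_e = (A† A)_{ee}`. -/
def R (e : Edge n m K) : ℝ := pinvDiag (P.incidence K) e

/-- Probability of a computation step; it balances the communication and computation rates:
`p_comm / p_comp = √(2 κ_s) / (m + √(m κ_s))`. -/
def pComp : ℝ := (1 + √(2 * P.kappaS K) / (m + √(m * P.kappaS K)))⁻¹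

/-- Probability of a communication step. -/
def pComm : ℝ := 1 - P.pComp K

/-- Sampling probabilities: a communication edge is uniform among the `n K` ones; a computation step
takes a uniform node `i`, then `j` with probability proportional to `√(1 + L_{ij} / σ̃)`. -/
def prob : Edge n m K → ℝ
  | Sum.inl _ => P.pComm K / (n * K)
  | Sum.inr (i, j) => P.pComp K / n *
      (√(1 + P.L i j / P.sigmaT K) / ∑ j' : Fin m, √(1 + P.L i j' / P.sigmaT K))

/-- The rate: the largest `ρ` with
`ρ² ≤ λ_min⁺(Aᵀ Σ⁻¹ A) / (Σ_u⁻¹ + Σ_v⁻¹) * p_e² / (μ_e² R_e)` for every edge `e = (u, v)`. -/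
def rho : ℝ := ⨅ e : Edge n m K,
  √(P.sigmaA K / ((P.Sig K e.src)⁻¹ + (P.Sig K e.dst)⁻¹) *
    (P.prob K e ^ 2 / (P.weight K e ^ 2 * P.R K e)))

/-- `A λ`, for a dual variable `λ` with one block in `ℝ^d` per edge. -/
def applyA (lam : Edge n m K → Vec d) (v : Vertex n m K) : Vec d :=
  ∑ e, P.incidence K v e • lam e

/-- Block `e` of the gradient `Aᵀ Σ⁻¹ A λ` of the quadratic part of the dual objective. -/
def gradQ (lam : Edge n m K → Vec d) (e : Edge n m K) : Vec d :=
  ∑ e', P.hessian K e e' • lam e'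

/-- The separable part of the dual objective. The dual objective is `q(λ) + ∑_e ψ_e(λ_e)`, which equals
`∑_{ij} f_{ij}*((Aλ)_{ij}) + (1/(2σ̃)) ∑_v ‖(Aλ)_v‖²`, with `v` over the nodes and tokens: the
`1/L_{ij}`-strong convexity of `f_{ij}*` is moved from `ψ` to `q`, and `(Aλ)_{ij} = μ_{ij} λ_{ij}`. -/
def psi : Edge n m K → Vec d → EReal
  | Sum.inl _, _ => 0
  | Sum.inr (i, j), u => conj (P.f i j) (P.weight K (Sum.inr (i, j)) • u) -
      ((P.weight K (Sum.inr (i, j)) ^ 2 / (2 * P.L i j) * ‖u‖ ^ 2 : ℝ) : EReal)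

end Problem

/-- The two dual sequences of the accelerated method. -/
structure State (n m d K : ℕ) where
  x : Edge n m K → Vec d
  v : Edge n m K → Vec d

namespace Problem

variable {n m d : ℕ} (P : Problem n m d) (K : ℕ)

/-- One step of the accelerated proximal coordinate gradient method on the dual, when the edge `e`
is sampled:
`y = (x + ρ v) / (1 + ρ)`, `w = (1 - ρ) v + ρ y`,
`v⁺_e = argmin_u ‖u - w_e‖² / 2 + ρ / (σ_A p_e) * (⟨∇_e q(y), u⟩ + ψ_e(u))`, `v⁺ = w` elsewhere,
`x⁺ = y + ρ R_e / p_e * (v⁺ - w)`. -/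
def step (s : State n m d K) (e : Edge n m K) : State n m d K :=
  let ρ := P.rho K
  let y := (1 + ρ)⁻¹ • (s.x + ρ • s.v)
  let w := (1 - ρ) • s.v + ρ • y
  let c := ρ / (P.sigmaA K * P.prob K e)
  let u := argmin fun u : Vec d =>
    ((‖u - w e‖ ^ 2 / 2 + c * inner ℝ (P.gradQ K y e) u : ℝ) : EReal) + (c : EReal) * P.psi K e u
  let v' := Function.update w e u
  { x := y + (ρ * P.R K e / P.prob K e) • (v' - w), v := v' }

/-- The dual starting point: zero on communication edges, and `(A λ)_{ij} = u_{ij}` at the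
computation vertices. -/
def initDual (u : Fin n → Fin m → Vec d) : Edge n m K → Vec d
  | Sum.inl _ => 0
  | Sum.inr (i, j) => (P.weight K (Sum.inr (i, j)))⁻¹ • u i j

/-- The iterates, for a given sequence of sampled edges. -/
def iter (u : Fin n → Fin m → Vec d) (ξ : ℕ → Edge n m K) : ℕ → State n m d K
  | 0 => { x := P.initDual K u, v := P.initDual K u }
  | t + 1 => P.step K (iter u ξ t) (ξ t)

/-- The parameter `θ_t^{token,k} = (A v_t)_{token k} / σ̃` held by token `k` after `t` iterations. -/
def tokenParam (u : Fin n → Fin m → Vec d) (ξ : ℕ → Edge n m K) (t : ℕ) (k : Fin K) : Vec d :=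
  (P.sigmaT K)⁻¹ • P.applyA K (P.iter K u ξ t).v (Vertex.token k)

/-- The edges `ξ 0, ξ 1, …` are sampled independently with the probabilities `P.prob K`. -/
structure IsSampling {Ω : Type*} [MeasurableSpace Ω] (μ : MeasureTheory.Measure Ω)
    (ξ : ℕ → Ω → Edge n m K) : Prop where
  measurable : ∀ t, Measurable (ξ t)
  indep : ProbabilityTheory.iIndepFun ξ μ
  law : ∀ t e, μ.real {ω | ξ t ω = e} = P.prob K e

end Problem

/-- Number of computation steps (proximal steps on a single function) of node `i` in the first `T`
iterations. -/
def compCount {n m K : ℕ} (ξ : ℕ → Edge n m K) (T : ℕ) (i : Fin n) : ℕ :=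
  ((Finset.range T).filter fun t => (ξ t).isCompOf i = true).card

/-- Number of jumps of token `k` in the first `T` iterations. -/
def jumpCount {n m K : ℕ} (ξ : ℕ → Edge n m K) (T : ℕ) (k : Fin K) : ℕ :=
  ((Finset.range T).filter fun t => (ξ t).isJumpOf k = true).card

end TAVR

end

/-! The method is accelerated proximal coordinate descent on the dual F = q + Σ ψ_e, analysed with a
Lyapunov function contracting by 1 - ρ in expectation; the complexity then follows from a lower
bound on ρ.

Dual optimum. At θ⋆ the gradients ∇f_{ij}(θ⋆) fill the computation blocks, and suitable
communication blocks make (Aλ⋆)_v = σ̃ θ⋆ at every node and token, because (n + K) σ̃ = n σ. Thus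
Σ⁻¹Aλ⋆ is in consensus, and -∇q(λ⋆) is a subgradient of Σ ψ_e (`dualOpt_subgradient`). Since f_{ij}
is L_{ij}-smooth, ψ_{ij} is a supremum of affine functions (`isSupAffine_conj_sub`), so proximal
steps are well defined and obey the three-point inequality.

Contraction. q is σ_A-strongly convex in the seminorm of Q = A†A, which Aλ determines and is
controlled by. Q is not block-diagonal, but it is the identity on computation edges, whose
coordinates vanish on ker A, while on the remaining edges ψ = 0 and the proximal step is a plain
gradient step. In both cases the proximal inequality holds with factor R_e = Q_ee, and
`accelerated_step` averages it over the edges. For the non-smooth part, x is written on computation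
edges as τ v + (1 - τ) r with τ = ρ / p_e in [ρ, 1], and ψ(x) is replaced by τ ψ(v) + (1 - τ) ψ(r);
the auxiliary points r evolve independently of the drawn edge. The resulting Lyapunov function
contracts (`Admissible.sum_prob_mul_lyapunov_le`) and dominates the squared seminorm distance of v
to λ⋆ (`Admissible.le_lyapunov`), hence the token errors.

Rate. A Poincaré inequality on the conceptual graph gives σ_A ≥ K / (2 σ̃ κ_s) (`le_sigmaA`), and
the complete bipartite graph between nodes and tokens gives R_{ik} ≤ 2 / K. The choices of α, p_{ij}
and p_comm / p_comp make both kinds of edges yield ρ ≥ p_comp / (2 n (m + √(m κ_s))) (`le_rho`).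
Since ρ T is of order log(1 + C₀/ε), the expected counts T p_comp / n and T p_comm / K have the
claimed sizes. -/

noncomputable section

namespace TAVR

open scoped Matrix

/-! ### Smooth and convex functions: descent lemma and gradient inequality. -/

section SmoothConvex

variable {V : Type*} [NormedAddCommGroup V] [InnerProductSpace ℝ V] [CompleteSpace V]

lemma hasDerivAt_comp_line {f : V → ℝ} (hf : Differentiable ℝ f) (x d : V) (t : ℝ) :
    HasDerivAt (fun s : ℝ => f (x + s • d)) (inner ℝ (gradient f (x + t • d)) d) t := by
  have h1 : HasDerivAt (fun s : ℝ => x + s • d) d t := by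
    simpa using ((hasDerivAt_id t).smul_const d).const_add x
  have h2 := (hf (x + t • d)).hasGradientAt.hasFDerivAt
  exact (h2.comp_hasDerivAt t h1).congr_deriv (InnerProductSpace.toDual_apply_apply ..)

/-- The descent lemma. -/
lemma le_of_lipschitz_gradient {f : V → ℝ} (hf : Differentiable ℝ f) {L : ℝ}
    (hL : ∀ x y, ‖gradient f x - gradient f y‖ ≤ L * ‖x - y‖) (x y : V) :
    f y ≤ f x + inner ℝ (gradient f x) (y - x) + L / 2 * ‖y - x‖ ^ 2 := by
  set d := y - x with hd
  -- The claim is φ 1 ≤ φ 0. By Cauchy–Schwarz and the Lipschitz bound at distance t‖d‖, the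
  -- derivative of φ is nonpositive on (0, 1).
  let φ : ℝ → ℝ := fun t => f (x + t • d) - t * inner ℝ (gradient f x) d - L / 2 * t ^ 2 * ‖d‖ ^ 2
  have hder : ∀ t, HasDerivAt φ (inner ℝ (gradient f (x + t • d)) d - inner ℝ (gradient f x) d
      - L * t * ‖d‖ ^ 2) t := by
    intro t
    have h1 := hasDerivAt_comp_line hf x d t
    have h2 : HasDerivAt (fun t : ℝ => t * inner ℝ (gradient f x) d)
        (inner ℝ (gradient f x) d) t := by
      simpa using (hasDerivAt_id t).mul_const (inner ℝ (gradient f x) d)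
    have h3 : HasDerivAt (fun t : ℝ => L / 2 * t ^ 2 * ‖d‖ ^ 2) (L * t * ‖d‖ ^ 2) t := by
      have := (((hasDerivAt_id t).pow 2).const_mul (L / 2)).mul_const (‖d‖ ^ 2)
      refine this.congr_deriv ?_
      simp only [id_eq, Nat.cast_ofNat, Nat.add_one_sub_one, pow_one, mul_one]
      ring
    exact (h1.sub h2).sub h3
  have hanti : AntitoneOn φ (Set.Icc 0 1) := by
    refine antitoneOn_of_deriv_nonpos (convex_Icc 0 1)
      (fun t _ => (hder t).continuousAt.continuousWithinAt)
      (fun t _ => (hder t).differentiableAt.differentiableWithinAt) ?_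
    intro t ht
    rw [interior_Icc] at ht
    rw [(hder t).deriv]
    have h1 : inner ℝ (gradient f (x + t • d)) d - inner ℝ (gradient f x) d
        = inner ℝ (gradient f (x + t • d) - gradient f x) d := by rw [inner_sub_left]
    have h2 := real_inner_le_norm (gradient f (x + t • d) - gradient f x) d
    have h3 := hL (x + t • d) x
    have h4 : ‖x + t • d - x‖ = t * ‖d‖ := by
      rw [add_sub_cancel_left, norm_smul, Real.norm_of_nonneg ht.1.le]
    rw [h4] at h3
    have h5 := mul_le_mul_of_nonneg_right h3 (norm_nonneg d)
    rw [h1]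
    nlinarith
  have := hanti (by simp) (by simp) zero_le_one
  simp only [φ, one_smul, zero_smul, add_zero] at this
  rw [hd, add_sub_cancel] at this
  nlinarith

lemma gradient_le_of_convexOn {f : V → ℝ} (hf : Differentiable ℝ f)
    (hc : ConvexOn ℝ Set.univ f) (x y : V) :
    f x + inner ℝ (gradient f x) (y - x) ≤ f y := by
  have h1 := hasDerivAt_comp_line hf x (y - x) 0
  have h2 : ConvexOn ℝ Set.univ (fun s : ℝ => f (x + s • (y - x))) := by
    have := hc.comp_affineMap (AffineMap.lineMap x y : ℝ →ᵃ[ℝ] V)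
    refine (this.subset (Set.subset_univ _) convex_univ).congr ?_
    intro s _
    simp [AffineMap.lineMap_apply, add_comm]
  have h3 := h2.le_slope_of_hasDerivAt (Set.mem_univ 0) (Set.mem_univ 1) zero_lt_one h1
  rw [slope_def_field] at h3
  simp only [one_smul, zero_smul, add_zero, sub_zero, div_one, add_sub_cancel] at h3
  linarith

end SmoothConvex

/-! ### Closed convex functions and their proximal steps. -/

section SupAffine

variable {V : Type*} [NormedAddCommGroup V] [InnerProductSpace ℝ V]

/-- Closed convex functions with values in `(-∞, ∞]`, presented as suprema of families of affine
functions. -/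
def IsSupAffine (Ψ : V → EReal) : Prop :=
  ∃ (a : V → V) (b : V → ℝ), ∀ u, Ψ u = ⨆ z, ((inner ℝ (a z) u + b z : ℝ) : EReal)

lemma IsSupAffine.zero : IsSupAffine (fun _ : V => (0 : EReal)) :=
  ⟨fun _ => 0, fun _ => 0, fun u => by simp⟩

variable {Ψ : V → EReal}

lemma IsSupAffine.ne_bot (h : IsSupAffine Ψ) (u : V) : Ψ u ≠ ⊥ := by
  obtain ⟨a, b, hab⟩ := h
  rw [hab]
  intro hbot
  have := iSup_eq_bot.1 hbot 0
  exact EReal.coe_ne_bot _ this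

lemma IsSupAffine.coe_toReal (h : IsSupAffine Ψ) {u : V} (hu : Ψ u ≠ ⊤) :
    (((Ψ u).toReal : ℝ) : EReal) = Ψ u := EReal.coe_toReal hu (h.ne_bot u)

lemma IsSupAffine.exists_affine_le (h : IsSupAffine Ψ) :
    ∃ (a : V) (b : ℝ), ∀ u, ((inner ℝ a u + b : ℝ) : EReal) ≤ Ψ u := by
  obtain ⟨a, b, hab⟩ := h
  exact ⟨a 0, b 0, fun u => by
    rw [hab]; exact le_iSup (fun z => ((inner ℝ (a z) u + b z : ℝ) : EReal)) 0⟩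

lemma IsSupAffine.convex (h : IsSupAffine Ψ) {u v : V} (hu : Ψ u ≠ ⊤) (hv : Ψ v ≠ ⊤) {s t : ℝ}
    (hs : 0 ≤ s) (ht : 0 ≤ t) (hst : s + t = 1) :
    Ψ (s • u + t • v) ≠ ⊤ ∧
      (Ψ (s • u + t • v)).toReal ≤ s * (Ψ u).toReal + t * (Ψ v).toReal := by
  have key : Ψ (s • u + t • v) ≤ ((s * (Ψ u).toReal + t * (Ψ v).toReal : ℝ) : EReal) := by
    have hu' := h.coe_toReal hu
    have hv' := h.coe_toReal hv
    obtain ⟨a, b, hab⟩ := h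
    rw [hab]
    refine iSup_le fun z => ?_
    rw [EReal.coe_le_coe_iff]
    have h1 : inner ℝ (a z) u + b z ≤ (Ψ u).toReal := by
      rw [← EReal.coe_le_coe_iff, hu', hab u]
      exact le_iSup (fun z => ((inner ℝ (a z) u + b z : ℝ) : EReal)) z
    have h2 : inner ℝ (a z) v + b z ≤ (Ψ v).toReal := by
      rw [← EReal.coe_le_coe_iff, hv', hab v]
      exact le_iSup (fun z => ((inner ℝ (a z) v + b z : ℝ) : EReal)) z
    rw [inner_add_right, inner_smul_right, inner_smul_right]
    have hb : b z = s * b z + t * b z := by rw [← add_mul, hst, one_mul]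
    nlinarith [mul_le_mul_of_nonneg_left h1 hs, mul_le_mul_of_nonneg_left h2 ht]
  have hne : Ψ (s • u + t • v) ≠ ⊤ := ne_top_of_le_ne_top (EReal.coe_ne_top _) key
  refine ⟨hne, ?_⟩
  rw [← EReal.coe_le_coe_iff, h.coe_toReal hne]
  exact key

lemma coe_add_coe_mul_le_coe_iff {c : ℝ} (hc : 0 < c) (q y : ℝ) (X : EReal) :
    (q : EReal) + (c : EReal) * X ≤ (y : EReal) ↔ X ≤ (((y - q) / c : ℝ) : EReal) := by
  induction X with
  | bot => simp [EReal.coe_mul_bot_of_pos hc]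
  | top => simp [EReal.coe_mul_top_of_pos hc]
  | coe r =>
    rw [← EReal.coe_mul, ← EReal.coe_add, EReal.coe_le_coe_iff, EReal.coe_le_coe_iff,
      le_div_iff₀ hc]
    constructor <;> intro h <;> linarith

/-- The objective of a proximal step. -/
def proxObjective (Ψ : V → EReal) (w g : V) (c : ℝ) (u : V) : EReal :=
  ((‖u - w‖ ^ 2 / 2 + c * inner ℝ g u : ℝ) : EReal) + (c : EReal) * Ψ u

lemma proxObjective_of_ne_top (h : IsSupAffine Ψ) {u : V} (hu : Ψ u ≠ ⊤) (w g : V) (c : ℝ) :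
    proxObjective Ψ w g c u =
      ((‖u - w‖ ^ 2 / 2 + c * inner ℝ g u + c * (Ψ u).toReal : ℝ) : EReal) := by
  rw [proxObjective, ← h.coe_toReal hu, ← EReal.coe_mul, ← EReal.coe_add, EReal.toReal_coe]

lemma ne_top_of_proxObjective_le {c : ℝ} (hc : 0 < c) {w g u : V} {y : ℝ}
    (h : proxObjective Ψ w g c u ≤ y) : Ψ u ≠ ⊤ := by
  rw [proxObjective, coe_add_coe_mul_le_coe_iff hc] at h
  exact ne_top_of_le_ne_top (EReal.coe_ne_top _) h

/-- A sublevel set at a real level is an intersection, over the affine pieces of Ψ, of closed sets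
cut out by continuous functions. The level ⊥ is the intersection of all real levels. -/
lemma lowerSemicontinuous_proxObjective (h : IsSupAffine Ψ) (w g : V) {c : ℝ} (hc : 0 < c) :
    LowerSemicontinuous (proxObjective Ψ w g c) := by
  rw [lowerSemicontinuous_iff_isClosed_preimage]
  obtain ⟨a, b, hab⟩ := h
  have hreal : ∀ y : ℝ, IsClosed (proxObjective Ψ w g c ⁻¹' Set.Iic (y : EReal)) := by
    intro y
    have : proxObjective Ψ w g c ⁻¹' Set.Iic (y : EReal) =
        ⋂ z, {u | inner ℝ (a z) u + b z ≤ (y - (‖u - w‖ ^ 2 / 2 + c * inner ℝ g u)) / c} := by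
      ext u
      simp only [Set.mem_preimage, Set.mem_Iic, proxObjective, Set.mem_iInter, Set.mem_ofPred_eq]
      rw [coe_add_coe_mul_le_coe_iff hc, hab, iSup_le_iff]
      simp only [EReal.coe_le_coe_iff]
    rw [this]
    refine isClosed_iInter fun z => isClosed_le ?_ ?_ <;> fun_prop
  intro y
  induction y with
  | top => simp
  | coe y => exact hreal y
  | bot =>
    have : proxObjective Ψ w g c ⁻¹' Set.Iic (⊥ : EReal) =
        ⋂ y : ℝ, proxObjective Ψ w g c ⁻¹' Set.Iic (y : EReal) := by
      ext u
      simp only [Set.mem_preimage, Set.mem_Iic, Set.mem_iInter]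
      refine ⟨fun h y => h.trans bot_le, fun h => ?_⟩
      rw [le_bot_iff, EReal.eq_bot_iff_forall_lt]
      intro y
      exact (h (y - 1)).trans_lt (by exact_mod_cast sub_one_lt y)
    rw [this]
    exact isClosed_iInter hreal

/-- An affine minorant of Ψ cannot compensate the quadratic term, so the objective is coercive. A
minimizer over a large closed ball exists by lower semicontinuity and compactness, and it is global.
-/
lemma exists_forall_proxObjective_le [ProperSpace V] (h : IsSupAffine Ψ) {u₀ : V}
    (hu₀ : Ψ u₀ ≠ ⊤) (w g : V) {c : ℝ} (hc : 0 < c) :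
    ∃ u, ∀ u', proxObjective Ψ w g c u ≤ proxObjective Ψ w g c u' := by
  obtain ⟨a, b, hab⟩ := h.exists_affine_le
  set D : V := c • (g + a) with hD
  set M : ℝ := ‖u₀ - w‖ ^ 2 / 2 + c * inner ℝ g u₀ + c * (Ψ u₀).toReal with hM
  set M' : ℝ := M - inner ℝ D w - c * b with hM'
  -- With s = ‖u - w‖, a value at most M forces s²/2 - ‖D‖ s ≤ M'. For s > r the left side is s (s/2
  -- - ‖D‖) > 1/2 + |M'|, a contradiction.
  set r : ℝ := 2 * ‖D‖ + 1 + 2 * |M'| with hr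
  have hlow : ∀ u, u ∉ Metric.closedBall w r → (M : EReal) < proxObjective Ψ w g c u := by
    intro u hu
    by_contra hcon
    rw [not_lt, proxObjective, coe_add_coe_mul_le_coe_iff hc] at hcon
    have h1 := (hab u).trans hcon
    rw [EReal.coe_le_coe_iff, le_div_iff₀ hc] at h1
    rw [Metric.mem_closedBall, not_le, dist_eq_norm] at hu
    have h2 : inner ℝ D (u - w) = c * inner ℝ g u + c * inner ℝ a u - inner ℝ D w := by
      rw [hD, inner_sub_right, real_inner_smul_left, inner_add_left]; ring
    have h3 : -(‖D‖ * ‖u - w‖) ≤ inner ℝ D (u - w) :=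
      neg_le_of_abs_le (abs_real_inner_le_norm D (u - w))
    have h4 : ‖u - w‖ ^ 2 / 2 - ‖D‖ * ‖u - w‖ ≤ M' := by rw [hM']; nlinarith
    have h5 := le_abs_self M'
    have h6 := abs_nonneg M'
    have h7 := norm_nonneg D
    nlinarith
  obtain ⟨u, -, hu⟩ := LowerSemicontinuousOn.exists_isMinOn (s := Metric.closedBall w r)
    ⟨w, Metric.mem_closedBall_self (by positivity)⟩ (isCompact_closedBall w r)
    ((lowerSemicontinuous_proxObjective h w g hc).lowerSemicontinuousOn _)
  have hu0 : u₀ ∈ Metric.closedBall w r := by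
    by_contra hcon
    have := hlow u₀ hcon
    rw [proxObjective_of_ne_top h hu₀] at this
    exact lt_irrefl _ this
  refine ⟨u, fun u' => ?_⟩
  by_cases hu' : u' ∈ Metric.closedBall w r
  · exact hu hu'
  · refine (hu hu0).trans ?_
    rw [proxObjective_of_ne_top h hu₀ w g c]
    exact (hlow u' hu').le

/-- The three-point inequality for a proximal step. -/
lemma three_point (h : IsSupAffine Ψ) {w g p : V} {c : ℝ} (hc : 0 < c)
    (hp : ∀ u', proxObjective Ψ w g c p ≤ proxObjective Ψ w g c u') {u : V} (hu : Ψ u ≠ ⊤) :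
    Ψ p ≠ ⊤ ∧ ‖p - w‖ ^ 2 / 2 + c * inner ℝ g p + c * (Ψ p).toReal + ‖u - p‖ ^ 2 / 2 ≤
      ‖u - w‖ ^ 2 / 2 + c * inner ℝ g u + c * (Ψ u).toReal := by
  have hpt : Ψ p ≠ ⊤ := by
    have := hp u
    rw [proxObjective_of_ne_top h hu] at this
    exact ne_top_of_proxObjective_le hc this
  refine ⟨hpt, ?_⟩
  -- Minimality of p is tested at (1 - s) p + s u. The exact strong convexity of the quadratic
  -- leaves s (1 - s) ‖u - p‖² / 2; dividing by s and letting s → 0 gives the claim.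
  have key : ∀ s : ℝ, 0 < s → s ≤ 1 →
      ‖p - w‖ ^ 2 / 2 + c * inner ℝ g p + c * (Ψ p).toReal + (1 - s) * (‖u - p‖ ^ 2 / 2) ≤
      ‖u - w‖ ^ 2 / 2 + c * inner ℝ g u + c * (Ψ u).toReal := by
    intro s hs hs1
    obtain ⟨h1, h2⟩ := h.convex hpt hu (sub_nonneg.2 hs1) hs.le (sub_add_cancel 1 s)
    have h3 := hp ((1 - s) • p + s • u)
    rw [proxObjective_of_ne_top h hpt, proxObjective_of_ne_top h h1, EReal.coe_le_coe_iff] at h3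
    have h4 : (1 - s) • p + s • u - w = (1 - s) • (p - w) + s • (u - w) := by module
    have h5 : ‖u - p‖ ^ 2 = ‖u - w‖ ^ 2 - 2 * inner ℝ (u - w) (p - w) + ‖p - w‖ ^ 2 := by
      rw [← norm_sub_sq_real]; congr 2; abel
    have h6 : ‖(1 - s) • p + s • u - w‖ ^ 2 =
        (1 - s) * ‖p - w‖ ^ 2 + s * ‖u - w‖ ^ 2 - s * (1 - s) * ‖u - p‖ ^ 2 := by
      rw [h4, norm_add_sq_real, norm_smul, norm_smul, inner_smul_left, inner_smul_right, mul_pow,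
        mul_pow, Real.norm_eq_abs, Real.norm_eq_abs, sq_abs, sq_abs, h5,
        real_inner_comm (u - w) (p - w)]
      simp only [conj_trivial]
      rw [real_inner_comm (p - w) (u - w)]
      ring
    rw [h6, inner_add_right, inner_smul_right, inner_smul_right] at h3
    have h7 := mul_le_mul_of_nonneg_left h2 hc.le
    have h8 : s * (‖p - w‖ ^ 2 / 2 + c * inner ℝ g p + c * (Ψ p).toReal
        + (1 - s) * (‖u - p‖ ^ 2 / 2)) ≤
        s * (‖u - w‖ ^ 2 / 2 + c * inner ℝ g u + c * (Ψ u).toReal) := by linarith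
    exact le_of_mul_le_mul_left h8 hs
  have hlim : Filter.Tendsto (fun s : ℝ => ‖p - w‖ ^ 2 / 2 + c * inner ℝ g p + c * (Ψ p).toReal
      + (1 - s) * (‖u - p‖ ^ 2 / 2)) (nhdsWithin 0 (Set.Ioi 0))
      (nhds (‖p - w‖ ^ 2 / 2 + c * inner ℝ g p + c * (Ψ p).toReal
      + (1 - 0) * (‖u - p‖ ^ 2 / 2))) := by
    refine Filter.Tendsto.mono_left (Continuous.tendsto ?_ 0) nhdsWithin_le_nhds
    fun_prop
  rw [sub_zero, one_mul] at hlim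
  refine le_of_tendsto hlim ?_
  filter_upwards [Ioc_mem_nhdsGT (zero_lt_one (α := ℝ))] with s hs
  exact key s hs.1 hs.2

end SupAffine

/-! ### Fenchel conjugates of smooth functions. -/

section Conjugate

variable {d : ℕ}

/-- Moving from z by δ = (w - ∇f(z)) / L maximizes the lower bound that the descent lemma gives for
⟨w, ·⟩ - f, and the gain is exactly ‖w - ∇f(z)‖² / (2L). This form displays the 1/L-strong convexity
of f*. -/
lemma conj_eq_iSup_gradient {f : Vec d → ℝ} {L : ℝ} (hL : 0 < L) (hf : Differentiable ℝ f)
    (hsm : ∀ x y, ‖gradient f x - gradient f y‖ ≤ L * ‖x - y‖) (w : Vec d) :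
    conj f w = ⨆ z : Vec d,
      ((inner ℝ w z - f z + ‖w - gradient f z‖ ^ 2 / (2 * L) : ℝ) : EReal) := by
  apply le_antisymm
  · refine iSup_mono fun z => ?_
    rw [EReal.coe_le_coe_iff]
    have : 0 ≤ ‖w - gradient f z‖ ^ 2 / (2 * L) := by positivity
    linarith
  · refine iSup_le fun z => ?_
    set δ := L⁻¹ • (w - gradient f z) with hδ
    refine le_trans ?_ (le_iSup (fun θ => ((inner ℝ w θ - f θ : ℝ) : EReal)) (z + δ))
    rw [EReal.coe_le_coe_iff]
    have h1 := le_of_lipschitz_gradient hf hsm z (z + δ)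
    rw [add_sub_cancel_left] at h1
    have h2 : inner ℝ w δ - inner ℝ (gradient f z) δ = L⁻¹ * ‖w - gradient f z‖ ^ 2 := by
      rw [← inner_sub_left, hδ, inner_smul_right, real_inner_self_eq_norm_sq]
    have h3 : ‖δ‖ ^ 2 = L⁻¹ ^ 2 * ‖w - gradient f z‖ ^ 2 := by
      rw [hδ, norm_smul, mul_pow, Real.norm_eq_abs, sq_abs]
    rw [h3] at h1
    rw [inner_add_right]
    have h4 : L / 2 * (L⁻¹ ^ 2 * ‖w - gradient f z‖ ^ 2) = L⁻¹ * ‖w - gradient f z‖ ^ 2 / 2 := by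
      field_simp
    have h5 : ‖w - gradient f z‖ ^ 2 / (2 * L) = L⁻¹ * ‖w - gradient f z‖ ^ 2 / 2 := by
      field_simp
    linarith

/-- In the preceding formula with w = μ u, every term contains the same ‖μ u‖² / (2L). Subtracting
it leaves terms that are affine in u. -/
lemma isSupAffine_conj_sub {f : Vec d → ℝ} {L : ℝ} (hL : 0 < L) (hf : Differentiable ℝ f)
    (hsm : ∀ x y, ‖gradient f x - gradient f y‖ ≤ L * ‖x - y‖) (μ : ℝ) :
    IsSupAffine fun u : Vec d =>
      conj f (μ • u) - ((μ ^ 2 / (2 * L) * ‖u‖ ^ 2 : ℝ) : EReal) := by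
  refine ⟨fun z => μ • (z - L⁻¹ • gradient f z),
    fun z => ‖gradient f z‖ ^ 2 / (2 * L) - f z, fun u => ?_⟩
  have hterm : ∀ z : Vec d, inner ℝ (μ • u) z - f z + ‖μ • u - gradient f z‖ ^ 2 / (2 * L) =
      (inner ℝ (μ • (z - L⁻¹ • gradient f z)) u + (‖gradient f z‖ ^ 2 / (2 * L) - f z))
        + μ ^ 2 / (2 * L) * ‖u‖ ^ 2 := by
    intro z
    rw [norm_sub_sq_real, norm_smul, mul_pow, Real.norm_eq_abs, sq_abs, inner_smul_left,
      inner_smul_left, inner_smul_left, inner_sub_left, inner_smul_left, real_inner_comm z u,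
      real_inner_comm (gradient f z) u]
    simp only [conj_trivial]
    field_simp
    ring
  beta_reduce
  rw [conj_eq_iSup_gradient hL hf hsm]
  apply le_antisymm
  · rw [EReal.sub_le_iff_le_add (Or.inl (EReal.coe_ne_bot _)) (Or.inl (EReal.coe_ne_top _))]
    refine iSup_le fun z => ?_
    rw [hterm z, EReal.coe_add]
    gcongr
    exact le_iSup (fun z => ((inner ℝ (μ • (z - L⁻¹ • gradient f z)) u
      + (‖gradient f z‖ ^ 2 / (2 * L) - f z) : ℝ) : EReal)) z
  · refine iSup_le fun z => ?_
    rw [EReal.le_sub_iff_add_le (Or.inl (EReal.coe_ne_bot _)) (Or.inl (EReal.coe_ne_top _)),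
      ← EReal.coe_add, ← hterm z]
    exact le_iSup (fun z => ((inner ℝ (μ • u) z - f z
      + ‖μ • u - gradient f z‖ ^ 2 / (2 * L) : ℝ) : EReal)) z

/-- The subgradient inequality for `f* - ‖·‖² / (2 L)` at `∇f(θ)`. -/
lemma conj_sub_subgradient {f : Vec d → ℝ} {L : ℝ} (hL : 0 < L) (hf : Differentiable ℝ f)
    (hc : ConvexOn ℝ Set.univ f)
    (hsm : ∀ x y, ‖gradient f x - gradient f y‖ ≤ L * ‖x - y‖) {μ : ℝ} (θ u₀ : Vec d)
    (hu₀ : μ • u₀ = gradient f θ) :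
    conj f (μ • u₀) - ((μ ^ 2 / (2 * L) * ‖u₀‖ ^ 2 : ℝ) : EReal) ≠ ⊤ ∧
    ∀ u, conj f (μ • u) - ((μ ^ 2 / (2 * L) * ‖u‖ ^ 2 : ℝ) : EReal) ≠ ⊤ →
      (conj f (μ • u₀) - ((μ ^ 2 / (2 * L) * ‖u₀‖ ^ 2 : ℝ) : EReal)).toReal
        + inner ℝ (μ • θ - (μ ^ 2 / L) • u₀) (u - u₀) ≤
      (conj f (μ • u) - ((μ ^ 2 / (2 * L) * ‖u‖ ^ 2 : ℝ) : EReal)).toReal := by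
  -- At a gradient ∇f(θ), convexity makes θ attain the supremum defining the conjugate.
  have hval : conj f (μ • u₀) = ((inner ℝ (μ • u₀) θ - f θ : ℝ) : EReal) := by
    apply le_antisymm
    · refine iSup_le fun z => ?_
      rw [EReal.coe_le_coe_iff, hu₀]
      have := gradient_le_of_convexOn hf hc θ z
      rw [inner_sub_right] at this
      linarith
    · exact le_iSup (fun θ => ((inner ℝ (μ • u₀) θ - f θ : ℝ) : EReal)) θ
  rw [hval, ← EReal.coe_sub]
  refine ⟨EReal.coe_ne_top _, fun u hu => ?_⟩
  have hsup := isSupAffine_conj_sub hL hf hsm μ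
  rw [EReal.toReal_coe, ← EReal.coe_le_coe_iff, hsup.coe_toReal hu,
    EReal.le_sub_iff_add_le (Or.inl (EReal.coe_ne_bot _)) (Or.inl (EReal.coe_ne_top _)),
    ← EReal.coe_add, conj_eq_iSup_gradient hL hf hsm]
  -- The term z = θ of the supremum over gradients is the required affine minorant, touching at u₀;
  -- the bound becomes an identity.
  refine le_trans ?_ (le_iSup (fun z => ((inner ℝ (μ • u) z - f z
      + ‖μ • u - gradient f z‖ ^ 2 / (2 * L) : ℝ) : EReal)) θ)
  rw [EReal.coe_le_coe_iff, ← hu₀, ← smul_sub, norm_smul, mul_pow, Real.norm_eq_abs, sq_abs,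
    norm_sub_sq_real, inner_sub_right, inner_sub_left, inner_sub_left]
  simp only [inner_smul_left, conj_trivial, real_inner_self_eq_norm_sq,
    real_inner_comm u θ, real_inner_comm u₀ θ, real_inner_comm u u₀]
  apply le_of_eq
  field_simp
  ring

end Conjugate

/-! ### The projection `A† A` as a matrix. -/

section Pinv

variable {ι κ : Type*} [Fintype ι] [DecidableEq ι]

/-- The matrix `A† A` of the orthogonal projection onto `(ker A)ᗮ`. -/
def pinvProj (A : Matrix κ ι ℝ) : Matrix ι ι ℝ := fun e e' =>
  ((LinearMap.ker (Matrix.toEuclideanLin A))ᗮ.starProjection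
    (EuclideanSpace.single e' (1 : ℝ))) e

variable (A : Matrix κ ι ℝ)

lemma pinvDiag_eq [Fintype κ] [DecidableEq κ] (e : ι) : pinvDiag A e = pinvProj A e e := by
  simp [pinvDiag, pinvProj, EuclideanSpace.inner_single_left]

lemma pinvProj_comm (e e' : ι) : pinvProj A e e' = pinvProj A e' e := by
  have h := Submodule.inner_starProjection_left_eq_right
    (LinearMap.ker (Matrix.toEuclideanLin A))ᗮ
    (EuclideanSpace.single e (1 : ℝ)) (EuclideanSpace.single e' (1 : ℝ))
  rw [EuclideanSpace.inner_single_left, EuclideanSpace.inner_single_right] at h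
  simpa [pinvProj] using h.symm

lemma starProjection_apply_eq (x : EuclideanSpace ℝ ι) (e : ι) :
    ((LinearMap.ker (Matrix.toEuclideanLin A))ᗮ.starProjection x) e
      = ∑ e', pinvProj A e e' * x e' := by
  have h := Submodule.inner_starProjection_left_eq_right
    (LinearMap.ker (Matrix.toEuclideanLin A))ᗮ (EuclideanSpace.single e (1 : ℝ)) x
  rw [EuclideanSpace.inner_single_left] at h
  simp only [map_one, one_mul] at h
  rw [← h, PiLp.inner_apply]
  refine Finset.sum_congr rfl fun e' _ => ?_
  rw [pinvProj_comm]
  simp [pinvProj, mul_comm]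

lemma pinvProj_mulVec (x : ι → ℝ) :
    pinvProj A *ᵥ x = WithLp.ofLp ((LinearMap.ker (Matrix.toEuclideanLin A))ᗮ.starProjection
      (WithLp.toLp 2 x)) := by
  ext e
  rw [starProjection_apply_eq]
  rfl

lemma pinvProj_mul_self : pinvProj A * pinvProj A = pinvProj A := by
  apply Matrix.mulVec_injective
  ext1 x
  rw [← Matrix.mulVec_mulVec, pinvProj_mulVec, pinvProj_mulVec]
  congr 1
  exact (Submodule.starProjection_eq_self_iff).2 (Submodule.starProjection_apply_mem _ _)

lemma mul_pinvProj : A * pinvProj A = A := by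
  apply Matrix.mulVec_injective
  ext1 x
  rw [← Matrix.mulVec_mulVec, pinvProj_mulVec]
  set N := LinearMap.ker (Matrix.toEuclideanLin A) with hN
  have h1 : WithLp.toLp 2 x - Nᗮ.starProjection (WithLp.toLp 2 x) ∈ N := by
    have := Submodule.sub_starProjection_mem_orthogonal (K := Nᗮ) (WithLp.toLp 2 x)
    rwa [Submodule.orthogonal_orthogonal] at this
  rw [hN, LinearMap.mem_ker, map_sub, sub_eq_zero] at h1
  have h2 := congrArg WithLp.ofLp h1
  simpa [Matrix.toLpLin_apply] using h2.symm

lemma dotProduct_pinvProj_mulVec (x : ι → ℝ) :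
    x ⬝ᵥ (pinvProj A *ᵥ x) = ‖(LinearMap.ker (Matrix.toEuclideanLin A))ᗮ.starProjection
      (WithLp.toLp 2 x)‖ ^ 2 := by
  rw [← real_inner_self_eq_norm_sq, Submodule.inner_starProjection_left_eq_right,
    (Submodule.starProjection_eq_self_iff).2 (Submodule.starProjection_apply_mem _ _),
    pinvProj_mulVec, PiLp.inner_apply]
  simp only [dotProduct, RCLike.inner_apply, conj_trivial]
  exact Finset.sum_congr rfl fun _ _ => mul_comm _ _

/-- The diagonal entry is the squared norm of the projection of a basis vector onto (ker A)ᗮ. It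
vanishes only if that vector lies in ker A. -/
lemma pinvProj_diag_pos {e : ι} (he : A *ᵥ Pi.single e 1 ≠ 0) : 0 < pinvProj A e e := by
  have h : pinvProj A e e = (Pi.single e 1 : ι → ℝ) ⬝ᵥ (pinvProj A *ᵥ Pi.single e 1) := by simp
  rw [h, dotProduct_pinvProj_mulVec]
  have h2 : (0 : ℝ) ≤ ‖(LinearMap.ker (Matrix.toEuclideanLin A))ᗮ.starProjection
      (WithLp.toLp 2 (Pi.single e 1))‖ ^ 2 := by positivity
  refine lt_of_le_of_ne h2 fun h3 => he ?_
  have h4 := pow_eq_zero_iff (two_ne_zero) |>.1 h3.symm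
  rw [norm_eq_zero] at h4
  rw [← mul_pinvProj A, ← Matrix.mulVec_mulVec, pinvProj_mulVec, h4]
  simp

end Pinv

/-! ### The smallest positive eigenvalue as a strong convexity constant. -/

section LambdaMinPos

variable {ι : Type*} [Fintype ι] [DecidableEq ι] {M : Matrix ι ι ℝ}

lemma lambdaMinPos_le {t : ℝ} (ht : 0 < t) {x : ι → ℝ} (hx : x ≠ 0) (h : M *ᵥ x = t • x) :
    lambdaMinPos M ≤ t := by
  refine csInf_le ⟨0, fun _ hs => hs.1.le⟩ ⟨ht, ?_⟩
  exact Module.End.hasEigenvalue_of_hasEigenvector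
    (Module.End.hasEigenvector_iff.2 ⟨Module.End.mem_eigenspace_iff.2 (by simpa using h), hx⟩)

/-- The condition M ≠ 0 provides a positive eigenvalue, so the infimum is over a nonempty set and
does not take its default value 0. -/
lemma le_lambdaMinPos (hM : M.PosSemidef) (hM0 : M ≠ 0) {s : ℝ}
    (h : ∀ t : ℝ, 0 < t → ∀ x : ι → ℝ, x ≠ 0 → M *ᵥ x = t • x → s ≤ t) :
    s ≤ lambdaMinPos M := by
  refine le_csInf ?_ ?_
  · obtain ⟨v, t, ht, hv, hvt⟩ := hM.1.exists_eigenvector_of_ne_zero hM0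
    refine ⟨t, ?_, Module.End.hasEigenvalue_of_hasEigenvector
      (Module.End.hasEigenvector_iff.2 ⟨Module.End.mem_eigenspace_iff.2 (by simpa using hvt), hv⟩)⟩
    have h1 := hM.dotProduct_mulVec_nonneg v
    rw [hvt] at h1
    simp only [star_trivial, dotProduct_smul, smul_eq_mul] at h1
    have h2 : 0 < v ⬝ᵥ v := by
      refine lt_of_le_of_ne (dotProduct_self_star_nonneg v) fun h3 => hv ?_
      exact dotProduct_self_eq_zero.1 h3.symm
    exact lt_of_le_of_ne (nonneg_of_mul_nonneg_left h1 h2) ht.symm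
  · rintro t ⟨ht, hev⟩
    obtain ⟨x, hx⟩ := hev.exists_hasEigenvector
    exact h t ht x hx.2 (by simpa using hx.apply_eq_smul)

/-- A positive semidefinite matrix is bounded below by its smallest positive eigenvalue on the
orthogonal complement of its kernel. -/
lemma lambdaMinPos_mul_le (hM : M.PosSemidef) {x : EuclideanSpace ℝ ι}
    (hx : ∀ y : EuclideanSpace ℝ ι, M *ᵥ y.ofLp = 0 → inner ℝ y x = 0) :
    lambdaMinPos M * ‖x‖ ^ 2 ≤ x.ofLp ⬝ᵥ (M *ᵥ x.ofLp) := by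
  have hsymm := Matrix.isSymmetric_toEuclideanLin_iff.2 hM.1
  set b := hM.1.eigenvectorBasis with hb
  set l := hM.1.eigenvalues with hl
  have hbi : ∀ i, M *ᵥ (b i).ofLp = l i • (b i).ofLp := hM.1.mulVec_eigenvectorBasis
  have hT : ∀ i, Matrix.toEuclideanLin M (b i) = l i • b i := by
    intro i
    ext e
    simpa [Matrix.toLpLin_apply] using congrFun (hbi i) e
  have h1 : x.ofLp ⬝ᵥ (M *ᵥ x.ofLp) = inner ℝ x (Matrix.toEuclideanLin M x) := by
    rw [PiLp.inner_apply]
    simp [dotProduct, Matrix.toLpLin_apply, mul_comm]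
  rw [h1, ← real_inner_self_eq_norm_sq, ← b.sum_inner_mul_inner, ← b.sum_inner_mul_inner,
    Finset.mul_sum]
  refine Finset.sum_le_sum fun i _ => ?_
  rw [← hsymm (b i) x, hT, inner_smul_left, real_inner_comm (b i) x, conj_trivial]
  rcases (hM.eigenvalues_nonneg i).eq_or_lt with h0 | hpos
  · have : inner ℝ (b i) x = 0 := hx (b i) (by rw [hbi, hl, ← h0, zero_smul])
    simp [this]
  · have hne : (b i).ofLp ≠ 0 := by
      intro h
      have := b.orthonormal.ne_zero i
      exact this (by ext e; simpa using congrFun h e)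
    have := lambdaMinPos_le hpos hne (hbi i)
    nlinarith [mul_self_nonneg (inner ℝ (b i) x)]

/-- Strong convexity of `λ ↦ λᵀ Aᵀ D A λ / 2` in the seminorm of `A† A`. -/
lemma lambdaMinPos_mul_dotProduct_le {κ : Type*} [Fintype κ] [DecidableEq κ] (A : Matrix κ ι ℝ)
    {D : κ → ℝ} (hD : ∀ v, 0 < D v) (x : ι → ℝ) :
    lambdaMinPos (A.transpose * Matrix.diagonal D * A) * (x ⬝ᵥ (pinvProj A *ᵥ x)) ≤
      x ⬝ᵥ ((A.transpose * Matrix.diagonal D * A) *ᵥ x) := by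
  set M := A.transpose * Matrix.diagonal D * A with hMdef
  have hq : ∀ y : ι → ℝ, y ⬝ᵥ (M *ᵥ y) = ∑ v, D v * (A *ᵥ y) v ^ 2 := by
    intro y
    rw [hMdef, ← Matrix.mulVec_mulVec, ← Matrix.mulVec_mulVec, Matrix.dotProduct_mulVec,
      Matrix.vecMul_transpose, dotProduct]
    refine Finset.sum_congr rfl fun v _ => ?_
    rw [Matrix.mulVec_diagonal]
    ring
  have hM : M.PosSemidef := by
    refine Matrix.PosSemidef.of_dotProduct_mulVec_nonneg ?_ fun y => ?_
    · rw [Matrix.IsHermitian, hMdef, Matrix.conjTranspose_eq_transpose_of_trivial,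
        Matrix.transpose_mul, Matrix.transpose_mul, Matrix.transpose_transpose,
        Matrix.diagonal_transpose, Matrix.mul_assoc]
    · rw [star_trivial, hq]
      exact Finset.sum_nonneg fun v _ => mul_nonneg (hD v).le (sq_nonneg _)
  set N := LinearMap.ker (Matrix.toEuclideanLin A) with hN
  have h := lambdaMinPos_mul_le hM (x := Nᗮ.starProjection (WithLp.toLp 2 x)) ?_
  · rw [← dotProduct_pinvProj_mulVec, ← pinvProj_mulVec, hq, Matrix.mulVec_mulVec,
      mul_pinvProj, ← hq] at h
    exact h
  · intro y hy
    -- Positivity of D gives ker(Aᵀ D A) = ker A, so the projection of x is orthogonal to the kernel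
    -- of the whole matrix.
    have hyN : y ∈ N := by
      have h0 : ∑ v, D v * (A *ᵥ y.ofLp) v ^ 2 = 0 := by rw [← hq, hy, dotProduct_zero]
      rw [Finset.sum_eq_zero_iff_of_nonneg
        (fun v _ => mul_nonneg (hD v).le (sq_nonneg _))] at h0
      rw [hN, LinearMap.mem_ker]
      ext v
      have := h0 v (Finset.mem_univ v)
      rw [mul_eq_zero, or_iff_right (hD v).ne', sq_eq_zero_iff] at this
      simpa [Matrix.toLpLin_apply] using this
    exact Submodule.starProjection_apply_mem Nᗮ (WithLp.toLp 2 x) y hyN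

end LambdaMinPos

/-! ### The conceptual graph: incidence matrix, spectral gap, effective resistances. -/

namespace Problem

variable {n m d : ℕ} (P : Problem n m d) {K : ℕ}

lemma sigmaT_pos (hn : 0 < n) : 0 < P.sigmaT K := by
  have := P.σ_pos
  have hn' : (0 : ℝ) < n := by exact_mod_cast hn
  unfold sigmaT
  positivity

lemma le_kappaS (i : Fin n) : 1 + ∑ j : Fin m, P.L i j / P.sigmaT K ≤ P.kappaS K :=
  le_ciSup (f := fun i => 1 + ∑ j : Fin m, P.L i j / P.sigmaT K) (Set.finite_range _).bddAbove i

lemma one_le_kappaS (hn : 0 < n) : 1 ≤ P.kappaS K := by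
  refine le_trans ?_ (P.le_kappaS ⟨0, hn⟩)
  rw [le_add_iff_nonneg_right]
  exact Finset.sum_nonneg fun j _ => div_nonneg (P.L_pos _ j).le (P.sigmaT_pos hn).le

lemma kappaS_pos (hn : 0 < n) : 0 < P.kappaS K := zero_lt_one.trans_le (P.one_le_kappaS hn)

lemma alpha_pos (hn : 0 < n) (hK : 0 < K) : 0 < P.alpha K := by
  have h1 := P.sigmaT_pos (K := K) hn
  have h2 := P.kappaS_pos (K := K) hn
  have h3 : (0 : ℝ) < K := by exact_mod_cast hK
  unfold alpha
  positivity

lemma weight_pos (hn : 0 < n) (hK : 0 < K) (e : Edge n m K) : 0 < P.weight K e := by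
  rcases e with ⟨i, k⟩ | ⟨i, j⟩
  · exact zero_lt_one
  · exact Real.sqrt_pos.2 (mul_pos (P.alpha_pos hn hK) (P.L_pos i j))

lemma weight_comp_sq (hn : 0 < n) (hK : 0 < K) (i : Fin n) (j : Fin m) :
    P.weight K (Sum.inr (i, j)) ^ 2 = P.alpha K * P.L i j :=
  Real.sq_sqrt (mul_pos (P.alpha_pos hn hK) (P.L_pos i j)).le

lemma Sig_pos (hn : 0 < n) (v : Vertex n m K) : 0 < P.Sig K v := by
  rcases v with ⟨i, j⟩ | v
  · exact P.L_pos i j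
  · exact P.sigmaT_pos hn

section Incidence

variable {W : Type*} [AddCommGroup W] [Module ℝ W] (x : Edge n m K → W)

lemma sum_incidence_smul_token (k : Fin K) :
    ∑ e, P.incidence K (Vertex.token k) e • x e = -∑ i, x (Sum.inl (i, k)) := by
  rw [Fintype.sum_sum_type, Fintype.sum_prod_type, Fintype.sum_prod_type]
  simp [incidence, Edge.src, Edge.dst, Vertex.token, Vertex.node, Vertex.comp, weight, ite_smul]

lemma sum_incidence_smul_comp (i : Fin n) (j : Fin m) :
    ∑ e, P.incidence K (Vertex.comp i j) e • x e =
      P.weight K (Sum.inr (i, j)) • x (Sum.inr (i, j)) := by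
  rw [Fintype.sum_sum_type, Fintype.sum_prod_type]
  rw [Finset.sum_eq_single (i, j)]
  · simp [incidence, Edge.src, Edge.dst, Vertex.token, Vertex.node, Vertex.comp]
  · rintro ⟨i', j'⟩ - hne
    have : ¬ ((i, j) = (i', j')) := fun h => hne h.symm
    simp [incidence, Edge.src, Edge.dst, Vertex.node, Vertex.comp] at this ⊢
    tauto
  · simp

lemma sum_incidence_smul_node (i : Fin n) :
    ∑ e, P.incidence K (Vertex.node i) e • x e =
      ∑ k, x (Sum.inl (i, k)) - ∑ j, P.weight K (Sum.inr (i, j)) • x (Sum.inr (i, j)) := by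
  rw [Fintype.sum_sum_type, Fintype.sum_prod_type, Fintype.sum_prod_type, sub_eq_add_neg,
    ← Finset.sum_neg_distrib]
  congr 1
  · rw [Finset.sum_eq_single i]
    · simp [incidence, Edge.src, Edge.dst, Vertex.token, Vertex.node, weight]
    · intro i' _ hne
      simp [incidence, Edge.src, Edge.dst, Vertex.token, Vertex.node, weight, hne.symm]
    · simp
  · rw [Finset.sum_eq_single i]
    · simp [incidence, Edge.src, Edge.dst, Vertex.comp, Vertex.node]
    · intro i' _ hne
      simp [incidence, Edge.src, Edge.dst, Vertex.comp, Vertex.node, hne.symm]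
    · simp

end Incidence

lemma incidence_transpose_mulVec (z : Vertex n m K → ℝ) (e : Edge n m K) :
    ((P.incidence K)ᵀ *ᵥ z) e = P.weight K e * (z e.src - z e.dst) := by
  simp only [Matrix.mulVec, dotProduct, Matrix.transpose_apply, incidence, mul_sub, sub_mul,
    Finset.sum_sub_distrib]
  simp

lemma sum_incidence_mulVec (x : Edge n m K → ℝ) : ∑ v, (P.incidence K *ᵥ x) v = 0 := by
  have h : ∑ v, (P.incidence K *ᵥ x) v = (fun _ => 1) ⬝ᵥ (P.incidence K *ᵥ x) := by
    simp [dotProduct]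
  rw [h, Matrix.dotProduct_mulVec, ← Matrix.mulVec_transpose]
  have : (P.incidence K)ᵀ *ᵥ (fun _ => 1) = 0 := by
    ext e
    rw [incidence_transpose_mulVec]
    simp
  rw [this, zero_dotProduct]

lemma hessian_apply_self (e : Edge n m K) :
    P.hessian K e e = P.weight K e ^ 2 * ((P.Sig K e.src)⁻¹ + (P.Sig K e.dst)⁻¹) := by
  have hne : e.src ≠ e.dst := by
    rcases e with ⟨i, k⟩ | ⟨i, j⟩ <;>
      simp [Edge.src, Edge.dst, Vertex.node, Vertex.token, Vertex.comp]
  have h : ∀ v, P.incidence K v e * (P.Sig K v)⁻¹ * P.incidence K v e =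
      P.weight K e ^ 2 * ((if v = e.src then (P.Sig K v)⁻¹ else 0)
        + (if v = e.dst then (P.Sig K v)⁻¹ else 0)) := by
    intro v
    unfold incidence
    by_cases h1 : v = e.src
    · have h2 : v ≠ e.dst := fun h => hne (h1.symm.trans h)
      rw [if_pos h1, if_neg h2, if_pos h1, if_neg h2]; ring
    · by_cases h2 : v = e.dst
      · rw [if_neg h1, if_pos h2, if_neg h1, if_pos h2]; ring
      · rw [if_neg h1, if_neg h2, if_neg h1, if_neg h2]; ring
  rw [hessian, Matrix.mul_apply]
  simp only [Matrix.mul_diagonal, Matrix.transpose_apply, h]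
  rw [← Finset.mul_sum, Finset.sum_add_distrib]
  simp

lemma hessian_comm (e e' : Edge n m K) : P.hessian K e e' = P.hessian K e' e := by
  have : (P.hessian K)ᵀ = P.hessian K := by
    rw [hessian, Matrix.transpose_mul, Matrix.transpose_mul, Matrix.transpose_transpose,
      Matrix.diagonal_transpose, Matrix.mul_assoc]
  exact congrFun (congrFun this e') e

lemma dotProduct_hessian_mulVec (x : Edge n m K → ℝ) :
    x ⬝ᵥ (P.hessian K *ᵥ x) = ∑ v, (P.Sig K v)⁻¹ * (P.incidence K *ᵥ x) v ^ 2 := by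
  rw [hessian, ← Matrix.mulVec_mulVec, ← Matrix.mulVec_mulVec, Matrix.dotProduct_mulVec,
    Matrix.vecMul_transpose, dotProduct]
  refine Finset.sum_congr rfl fun v _ => ?_
  rw [Matrix.mulVec_diagonal]
  ring

lemma hessian_posSemidef (hn : 0 < n) : (P.hessian K).PosSemidef := by
  refine Matrix.PosSemidef.of_dotProduct_mulVec_nonneg ?_ fun y => ?_
  · ext e e'
    exact P.hessian_comm e' e
  · rw [star_trivial, dotProduct_hessian_mulVec]
    exact Finset.sum_nonneg fun v _ => mul_nonneg (inv_nonneg.2 (P.Sig_pos hn v).le) (sq_nonneg _)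

/-- With zero node sum the cross term in Σ_{i,k} (z_i - z_k)² vanishes, so the communication edges
control nodes and tokens exactly. Computation vertices are compared with their node by z_{ij}² ≤ 2
(z_{ij} - z_i)² + 2 z_i², and σ̃ + Σ_j L_{ij} ≤ σ̃ κ_s bounds the mass collected at a node. -/
lemma poincare_of_sum_node_eq_zero (hn : 0 < n) (hK : 0 < K) (hKn : K ≤ n)
    (z : Vertex n m K → ℝ) (hz : ∑ i, z (Vertex.node i) = 0) :
    K / (2 * (P.sigmaT K * P.kappaS K)) * ∑ v, P.Sig K v * z v ^ 2 ≤
      ∑ e : Edge n m K, P.weight K e ^ 2 * (z e.src - z e.dst) ^ 2 := by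
  have hs := P.sigmaT_pos (K := K) hn
  have hk1 := P.one_le_kappaS (K := K) hn
  have hk := P.kappaS_pos (K := K) hn
  have hK' : (0 : ℝ) < K := by exact_mod_cast hK
  have hKn' : (K : ℝ) ≤ n := by exact_mod_cast hKn
  set Zc : Fin n → Fin m → ℝ := fun i j => z (Vertex.comp i j) with hZc
  set Zn : Fin n → ℝ := fun i => z (Vertex.node i) with hZn
  set Zt : Fin K → ℝ := fun k => z (Vertex.token k) with hZt
  have hL : ∑ v, P.Sig K v * z v ^ 2 = ∑ i, ∑ j, P.L i j * Zc i j ^ 2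
      + (P.sigmaT K * ∑ i, Zn i ^ 2 + P.sigmaT K * ∑ k, Zt k ^ 2) := by
    rw [Fintype.sum_sum_type, Fintype.sum_sum_type, Fintype.sum_prod_type, Finset.mul_sum,
      Finset.mul_sum]
    rfl
  have hcomm : ∑ i, ∑ k, (Zn i - Zt k) ^ 2 = K * ∑ i, Zn i ^ 2 + n * ∑ k, Zt k ^ 2 := by
    simp only [sub_sq, Finset.sum_add_distrib, Finset.sum_sub_distrib, Finset.sum_const,
      Finset.card_univ, Fintype.card_fin, nsmul_eq_mul, ← Finset.mul_sum, ← Finset.sum_mul]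
    rw [hz]
    ring
  have hR : ∑ e : Edge n m K, P.weight K e ^ 2 * (z e.src - z e.dst) ^ 2 =
      (K * ∑ i, Zn i ^ 2 + n * ∑ k, Zt k ^ 2)
        + P.alpha K * ∑ i, ∑ j, P.L i j * (Zc i j - Zn i) ^ 2 := by
    rw [Fintype.sum_sum_type, Fintype.sum_prod_type, Fintype.sum_prod_type, ← hcomm]
    congr 1
    · simp [weight, Edge.src, Edge.dst, hZn, hZt]
    · rw [Finset.mul_sum]
      refine Finset.sum_congr rfl fun i _ => ?_
      rw [Finset.mul_sum]
      refine Finset.sum_congr rfl fun j _ => ?_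
      rw [P.weight_comp_sq hn hK, mul_assoc]
      rfl
  set S := ∑ i, ∑ j, P.L i j * (Zc i j - Zn i) ^ 2 with hS
  have hS0 : 0 ≤ S := Finset.sum_nonneg fun i _ => Finset.sum_nonneg fun j _ =>
    mul_nonneg (P.L_pos i j).le (sq_nonneg _)
  have hT0 : 0 ≤ ∑ k, Zt k ^ 2 := Finset.sum_nonneg fun k _ => sq_nonneg _
  have h1 : ∑ i, ∑ j, P.L i j * Zc i j ^ 2 + P.sigmaT K * ∑ i, Zn i ^ 2 ≤
      2 * S + 2 * (P.sigmaT K * P.kappaS K) * ∑ i, Zn i ^ 2 := by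
    rw [hS, Finset.mul_sum, Finset.mul_sum, Finset.mul_sum, ← Finset.sum_add_distrib,
      ← Finset.sum_add_distrib]
    refine Finset.sum_le_sum fun i _ => ?_
    have h2 : ∑ j, P.L i j * Zc i j ^ 2 ≤
        2 * ∑ j, P.L i j * (Zc i j - Zn i) ^ 2 + 2 * (∑ j, P.L i j) * Zn i ^ 2 := by
      rw [Finset.mul_sum, Finset.mul_sum, Finset.sum_mul, ← Finset.sum_add_distrib]
      refine Finset.sum_le_sum fun j _ => ?_
      have := P.L_pos i j
      nlinarith [sq_nonneg (Zc i j - 2 * Zn i), mul_nonneg this.le (sq_nonneg (Zc i j - 2 * Zn i))]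
    have h3 : P.sigmaT K + ∑ j, P.L i j ≤ P.sigmaT K * P.kappaS K := by
      have := mul_le_mul_of_nonneg_left (P.le_kappaS (K := K) i) hs.le
      rw [mul_add, mul_one, Finset.mul_sum] at this
      refine le_trans (le_of_eq ?_) this
      congr 1
      refine Finset.sum_congr rfl fun j _ => ?_
      field_simp
    have h4 := sq_nonneg (Zn i)
    nlinarith [mul_le_mul_of_nonneg_right h3 h4, mul_nonneg hs.le h4]
  rw [hL, hR, div_mul_eq_mul_div, div_le_iff₀ (by positivity)]
  -- This is the role of α: the computation energy has coefficient 4K, enough to absorb the 2K S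
  -- produced by the comparison.
  have ha : P.alpha K * (2 * (P.sigmaT K * P.kappaS K)) = 4 * K := by
    unfold alpha
    field_simp
    norm_num
  have h5 : ((K * ∑ i, Zn i ^ 2 + n * ∑ k, Zt k ^ 2) + P.alpha K * S)
      * (2 * (P.sigmaT K * P.kappaS K)) =
      (K * ∑ i, Zn i ^ 2 + n * ∑ k, Zt k ^ 2) * (2 * (P.sigmaT K * P.kappaS K)) + 4 * K * S := by
    rw [add_mul, mul_right_comm, ha]
  rw [h5]
  have h6 := mul_le_mul_of_nonneg_left h1 hK'.le
  have h7 : K * (P.sigmaT K * ∑ k, Zt k ^ 2) ≤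
      n * (∑ k, Zt k ^ 2) * (2 * (P.sigmaT K * P.kappaS K)) := by
    have h8 : P.sigmaT K ≤ 2 * (P.sigmaT K * P.kappaS K) := by nlinarith
    calc K * (P.sigmaT K * ∑ k, Zt k ^ 2) = (K * ∑ k, Zt k ^ 2) * P.sigmaT K := by ring
      _ ≤ (n * ∑ k, Zt k ^ 2) * (2 * (P.sigmaT K * P.kappaS K)) := by gcongr
  nlinarith [mul_nonneg hK'.le hS0]

/-- Edge differences do not change when z is shifted by a constant, and the Σ-weighted second moment
is smallest for the Σ-mean, here zero. Shifting to zero node sum therefore only increases the left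
side. -/
lemma poincare (hn : 0 < n) (hK : 0 < K) (hKn : K ≤ n)
    (z : Vertex n m K → ℝ) (hz : ∑ v, P.Sig K v * z v = 0) :
    K / (2 * (P.sigmaT K * P.kappaS K)) * ∑ v, P.Sig K v * z v ^ 2 ≤
      ∑ e : Edge n m K, P.weight K e ^ 2 * (z e.src - z e.dst) ^ 2 := by
  have hn' : (n : ℝ) ≠ 0 := by exact_mod_cast hn.ne'
  set c := (∑ i, z (Vertex.node i)) / n with hc
  have h := P.poincare_of_sum_node_eq_zero hn hK hKn (fun v => z v - c) (by
    rw [Finset.sum_sub_distrib]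
    simp [hc]
    field_simp
    simp)
  simp only [sub_sub_sub_cancel_right] at h
  refine le_trans ?_ h
  have hs := P.sigmaT_pos (K := K) hn
  have hk := P.kappaS_pos (K := K) hn
  refine mul_le_mul_of_nonneg_left ?_ (by positivity)
  have h1 : ∑ v, P.Sig K v * (z v - c) ^ 2 =
      ∑ v, P.Sig K v * z v ^ 2 - 2 * c * ∑ v, P.Sig K v * z v + c ^ 2 * ∑ v, P.Sig K v := by
    rw [Finset.mul_sum, Finset.mul_sum, ← Finset.sum_sub_distrib, ← Finset.sum_add_distrib]
    exact Finset.sum_congr rfl fun v _ => by ring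
  rw [h1, hz]
  have : 0 ≤ c ^ 2 * ∑ v, P.Sig K v :=
    mul_nonneg (sq_nonneg _) (Finset.sum_nonneg fun v _ => (P.Sig_pos hn v).le)
  linarith

lemma hessian_apply_self_pos (hn : 0 < n) (hK : 0 < K) (e : Edge n m K) :
    0 < P.hessian K e e := by
  rw [hessian_apply_self]
  have := P.weight_pos hn hK e
  have h1 := P.Sig_pos hn e.src
  have h2 := P.Sig_pos hn e.dst
  positivity

/-- If AᵀΣ⁻¹A x = t x, the potential z = Σ⁻¹A x has Σ-mean zero because the columns of A sum to
zero. Its weighted square norm is t ‖x‖² and its edge energy is ‖Aᵀz‖² = t² ‖x‖², so the Poincaré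
inequality bounds t from below. -/
lemma le_sigmaA (hn : 0 < n) (hK : 0 < K) (hKn : K ≤ n) :
    K / (2 * (P.sigmaT K * P.kappaS K)) ≤ P.sigmaA K := by
  refine le_lambdaMinPos (P.hessian_posSemidef hn) ?_ ?_
  · intro h0
    have := P.hessian_apply_self_pos hn hK (Sum.inl (⟨0, hn⟩, ⟨0, hK⟩))
    rw [h0] at this
    exact lt_irrefl _ this
  · intro t ht x hx hxt
    set z : Vertex n m K → ℝ := fun v => (P.Sig K v)⁻¹ * (P.incidence K *ᵥ x) v with hzdef
    have hSz : ∀ v, P.Sig K v * z v = (P.incidence K *ᵥ x) v := fun v =>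
      mul_inv_cancel_left₀ (P.Sig_pos hn v).ne' _
    have h := P.poincare hn hK hKn z (by
      rw [Finset.sum_congr rfl fun v _ => hSz v]; exact P.sum_incidence_mulVec x)
    have h1 : ∑ v, P.Sig K v * z v ^ 2 = t * (x ⬝ᵥ x) := by
      rw [← smul_eq_mul, ← dotProduct_smul, ← hxt, dotProduct_hessian_mulVec]
      refine Finset.sum_congr rfl fun v _ => ?_
      rw [pow_two, ← mul_assoc, hSz]
      simp only [hzdef]
      ring
    have h2 : ∑ e : Edge n m K, P.weight K e ^ 2 * (z e.src - z e.dst) ^ 2 = t ^ 2 * (x ⬝ᵥ x) := by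
      have h3 : (P.incidence K)ᵀ *ᵥ z = t • x := by
        rw [← hxt, hessian, ← Matrix.mulVec_mulVec, ← Matrix.mulVec_mulVec]
        congr 1
        ext v
        rw [Matrix.mulVec_diagonal]
      have h4 : ∀ e : Edge n m K, P.weight K e ^ 2 * (z e.src - z e.dst) ^ 2 = (t * x e) ^ 2 := by
        intro e
        rw [← mul_pow, ← incidence_transpose_mulVec, h3]
        rfl
      rw [Finset.sum_congr rfl fun e _ => h4 e, dotProduct, Finset.mul_sum]
      exact Finset.sum_congr rfl fun e _ => by ring
    rw [h1, h2] at h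
    have hxx : 0 < x ⬝ᵥ x := lt_of_le_of_ne (dotProduct_self_star_nonneg x)
      fun h3 => hx (dotProduct_self_eq_zero.1 h3.symm)
    have : 0 < t * (x ⬝ᵥ x) := mul_pos ht hxx
    refine le_of_mul_le_mul_right (h.trans_eq ?_) this
    ring

lemma sigmaA_pos (hn : 0 < n) (hK : 0 < K) (hKn : K ≤ n) : 0 < P.sigmaA K := by
  refine lt_of_lt_of_le ?_ (P.le_sigmaA hn hK hKn)
  have hs := P.sigmaT_pos (K := K) hn
  have hk := P.kappaS_pos (K := K) hn
  have hK' : (0 : ℝ) < K := by exact_mod_cast hK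
  positivity

lemma sigmaA_mul_le (hn : 0 < n) (x : Edge n m K → ℝ) :
    P.sigmaA K * (x ⬝ᵥ (pinvProj (P.incidence K) *ᵥ x)) ≤ x ⬝ᵥ (P.hessian K *ᵥ x) :=
  lambdaMinPos_mul_dotProduct_le (P.incidence K) (fun v => inv_pos.2 (P.Sig_pos hn v)) x

lemma hessian_mul_pinvProj : P.hessian K * pinvProj (P.incidence K) = P.hessian K := by
  rw [hessian, Matrix.mul_assoc, mul_pinvProj]

lemma mem_ker_incidence_iff (x : EuclideanSpace ℝ (Edge n m K)) :
    x ∈ LinearMap.ker (Matrix.toEuclideanLin (P.incidence K)) ↔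
      ∀ v, ∑ e, P.incidence K v e • x e = 0 := by
  rw [LinearMap.mem_ker]
  constructor
  · intro h v
    simpa [Matrix.toLpLin_apply, Matrix.mulVec, dotProduct] using congrFun (congrArg WithLp.ofLp h) v
  · intro h
    ext v
    simpa [Matrix.toLpLin_apply, Matrix.mulVec, dotProduct] using h v

lemma apply_comp_of_mem_ker (hn : 0 < n) (hK : 0 < K) {x : EuclideanSpace ℝ (Edge n m K)}
    (hx : x ∈ LinearMap.ker (Matrix.toEuclideanLin (P.incidence K))) (i : Fin n) (j : Fin m) :
    x (Sum.inr (i, j)) = 0 := by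
  have h := (P.mem_ker_incidence_iff x).1 hx (Vertex.comp i j)
  rw [P.sum_incidence_smul_comp (fun e => x e), smul_eq_mul] at h
  exact (mul_eq_zero.1 h).resolve_left (P.weight_pos hn hK _).ne'

/-- A computation vertex is a leaf, so every element of ker A vanishes on its edge and the basis
vector of that edge is already orthogonal to ker A. -/
lemma pinvProj_comp (hn : 0 < n) (hK : 0 < K) (i : Fin n) (j : Fin m) (e : Edge n m K) :
    pinvProj (P.incidence K) e (Sum.inr (i, j)) = if e = Sum.inr (i, j) then 1 else 0 := by
  unfold pinvProj
  rw [Submodule.starProjection_eq_self_iff.2]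
  · simp
  · intro x hx
    rw [EuclideanSpace.inner_single_right, P.apply_comp_of_mem_ker hn hK hx]
    simp

lemma R_comp (hn : 0 < n) (hK : 0 < K) (i : Fin n) (j : Fin m) : P.R K (Sum.inr (i, j)) = 1 := by
  rw [R, pinvDiag_eq, P.pinvProj_comp hn hK, if_pos rfl]

lemma R_pos (hn : 0 < n) (hK : 0 < K) (e : Edge n m K) : 0 < P.R K e := by
  rw [R, pinvDiag_eq]
  refine pinvProj_diag_pos _ fun h => ?_
  have := congrFun h e.src
  have hne : e.src ≠ e.dst := by
    rcases e with ⟨i, k⟩ | ⟨i, j⟩ <;>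
      simp [Edge.src, Edge.dst, Vertex.node, Vertex.token, Vertex.comp]
  simp [incidence, hne, (P.weight_pos hn hK e).ne'] at this

/-- The effective resistance of a communication edge (complete bipartite graph). -/
lemma R_comm (hn : 0 < n) (hK : 0 < K) (i : Fin n) (k : Fin K) :
    P.R K (Sum.inl (i, k)) = 1 / K + 1 / n - 1 / (n * K) := by
  have hn' : (n : ℝ) ≠ 0 := by exact_mod_cast hn.ne'
  have hK' : (K : ℝ) ≠ 0 := by exact_mod_cast hK.ne'
  -- On communication edges ker A consists of the arrays with zero row and column sums. The
  -- candidate projection is a row function plus a column function, hence orthogonal to these, with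
  -- the same row and column sums as the basis vector.
  set x : EuclideanSpace ℝ (Edge n m K) := WithLp.toLp 2 fun e => match e with
    | Sum.inl (i', k') => (if i' = i then 1 / (K : ℝ) else 0) + (if k' = k then 1 / (n : ℝ) else 0)
        - 1 / (n * K)
    | Sum.inr _ => 0 with hx
  have hxl : ∀ i' k', x (Sum.inl (i', k')) = (if i' = i then 1 / (K : ℝ) else 0)
      + (if k' = k then 1 / (n : ℝ) else 0) - 1 / (n * K) := fun _ _ => rfl
  have hxr : ∀ e, x (Sum.inr e) = 0 := fun _ => rfl
  have hsl : ∀ i' k', (EuclideanSpace.single (Sum.inl (i, k) : Edge n m K) (1 : ℝ))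
      (Sum.inl (i', k')) = if i' = i then (if k' = k then 1 else 0) else 0 := by
    intro i' k'
    simp [← ite_and]
  have hsr : ∀ e, (EuclideanSpace.single (Sum.inl (i, k) : Edge n m K) (1 : ℝ))
      (Sum.inr e) = 0 := by
    intro e
    simp
  have hproj : (LinearMap.ker (Matrix.toEuclideanLin (P.incidence K)))ᗮ.starProjection
      (EuclideanSpace.single (Sum.inl (i, k)) (1 : ℝ)) = x := by
    refine Submodule.eq_starProjection_of_mem_orthogonal ?_ ?_
    · intro y hy
      have hker := (P.mem_ker_incidence_iff y).1 hy
      have hcomp := P.apply_comp_of_mem_ker hn hK hy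
      have hnode : ∀ i', ∑ k', y (Sum.inl (i', k')) = 0 := by
        intro i'
        have := hker (Vertex.node i')
        rw [P.sum_incidence_smul_node (fun e => y e)] at this
        simpa [hcomp] using this
      have htok : ∀ k', ∑ i', y (Sum.inl (i', k')) = 0 := by
        intro k'
        have := hker (Vertex.token k')
        rw [P.sum_incidence_smul_token (fun e => y e)] at this
        simpa using this
      rw [PiLp.inner_apply, Fintype.sum_sum_type, Fintype.sum_prod_type]
      simp only [hxl, hxr, RCLike.inner_apply, conj_trivial, zero_mul, Finset.sum_const_zero,
        add_zero, sub_mul, add_mul, Finset.sum_sub_distrib, Finset.sum_add_distrib,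
        ← Finset.mul_sum, hnode, mul_zero, sub_zero, zero_add]
      rw [Finset.sum_comm]
      simp only [← Finset.mul_sum, htok, mul_zero, Finset.sum_const_zero]
    · rw [Submodule.orthogonal_orthogonal, mem_ker_incidence_iff]
      intro v
      rcases v with ⟨i', j'⟩ | i' | k'
      · have := P.sum_incidence_smul_comp (K := K) (fun e =>
          ((EuclideanSpace.single (Sum.inl (i, k)) (1 : ℝ) - x : EuclideanSpace ℝ (Edge n m K))) e) i' j'
        refine this.trans ?_
        simp [hxr]
      · have := P.sum_incidence_smul_node (K := K) (fun e =>
          ((EuclideanSpace.single (Sum.inl (i, k)) (1 : ℝ) - x : EuclideanSpace ℝ (Edge n m K))) e) i'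
        refine this.trans ?_
        simp only [PiLp.sub_apply, hxl, hxr, hsl, hsr, Finset.sum_sub_distrib,
          Finset.sum_add_distrib]
        by_cases h : i' = i
        · simp [h]; field_simp; ring
        · simp [h]; field_simp; ring
      · have := P.sum_incidence_smul_token (K := K) (fun e =>
          ((EuclideanSpace.single (Sum.inl (i, k)) (1 : ℝ) - x : EuclideanSpace ℝ (Edge n m K))) e) k'
        refine this.trans ?_
        simp only [PiLp.sub_apply, hxl, hsl, Finset.sum_sub_distrib,
          Finset.sum_add_distrib]
        by_cases h : k' = k
        · simp [h]; field_simp; ring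
        · simp [h]; field_simp; ring
  rw [R, pinvDiag_eq, pinvProj, hproj, hxl, if_pos rfl, if_pos rfl]

end Problem

/-! ### Block quadratic forms and the accelerated coordinate step. -/

section Blocks

variable {E : Type*} [Fintype E] {V : Type*} [NormedAddCommGroup V] [InnerProductSpace ℝ V]

/-- The action of a scalar matrix on a family of blocks. -/
def mulBlk (M : Matrix E E ℝ) (a : E → V) (e : E) : V := ∑ e', M e e' • a e'

/-- The bilinear form of a scalar matrix on families of blocks. -/
def bilBlk (M : Matrix E E ℝ) (a b : E → V) : ℝ := ∑ e, inner ℝ (mulBlk M a e) (b e)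

variable (M N : Matrix E E ℝ) (a b c : E → V)

lemma mulBlk_sub : mulBlk M (a - b) = mulBlk M a - mulBlk M b := by
  ext e; simp [mulBlk, smul_sub]

lemma mulBlk_mulBlk : mulBlk M (mulBlk N a) = mulBlk (M * N) a := by
  ext e
  simp only [mulBlk, Matrix.mul_apply, Finset.smul_sum, Finset.sum_smul, smul_smul]
  exact Finset.sum_comm

lemma bilBlk_eq : bilBlk M a b = ∑ e, ∑ e', M e e' * inner ℝ (a e') (b e) := by
  simp [bilBlk, mulBlk, sum_inner, inner_smul_left]

lemma bilBlk_add_left : bilBlk M (a + b) c = bilBlk M a c + bilBlk M b c := by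
  simp [bilBlk_eq, inner_add_left, mul_add, Finset.sum_add_distrib]

lemma bilBlk_add_right : bilBlk M a (b + c) = bilBlk M a b + bilBlk M a c := by
  simp [bilBlk_eq, inner_add_right, mul_add, Finset.sum_add_distrib]

lemma bilBlk_smul_left (r : ℝ) : bilBlk M (r • a) b = r * bilBlk M a b := by
  simp [bilBlk_eq, inner_smul_left, Finset.mul_sum, mul_left_comm]

lemma bilBlk_smul_right (r : ℝ) : bilBlk M a (r • b) = r * bilBlk M a b := by
  simp [bilBlk_eq, inner_smul_right, Finset.mul_sum, mul_left_comm]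

lemma bilBlk_sub_left : bilBlk M (a - b) c = bilBlk M a c - bilBlk M b c := by
  simp [bilBlk_eq, inner_sub_left, mul_sub, Finset.sum_sub_distrib]

lemma bilBlk_sub_right : bilBlk M a (b - c) = bilBlk M a b - bilBlk M a c := by
  simp [bilBlk_eq, inner_sub_right, mul_sub, Finset.sum_sub_distrib]

variable {M} in
lemma bilBlk_comm (hM : ∀ e e', M e e' = M e' e) : bilBlk M a b = bilBlk M b a := by
  rw [bilBlk_eq, bilBlk_eq, Finset.sum_comm]
  refine Finset.sum_congr rfl fun e _ => Finset.sum_congr rfl fun e' _ => ?_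
  rw [hM, real_inner_comm]

lemma bilBlk_single [DecidableEq E] (e : E) (δ : V) :
    bilBlk M a (Pi.single e δ) = inner ℝ (mulBlk M a e) δ := by
  rw [bilBlk, Finset.sum_eq_single e]
  · simp
  · intro e' _ hne
    simp [hne]
  · simp

lemma bilBlk_single_single [DecidableEq E] (e : E) (δ : V) :
    bilBlk M (Pi.single e δ) (Pi.single e δ) = M e e * ‖δ‖ ^ 2 := by
  rw [bilBlk_single, mulBlk, Finset.sum_eq_single e]
  · simp [inner_smul_left]
  · intro e' _ hne
    simp [hne]
  · simp

variable {M N}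

lemma bilBlk_self_add_single [DecidableEq E] (hM : ∀ e e', M e e' = M e' e) (e : E) (δ : V) :
    bilBlk M (a + Pi.single e δ) (a + Pi.single e δ) =
      bilBlk M a a + 2 * inner ℝ (mulBlk M a e) δ + M e e * ‖δ‖ ^ 2 := by
  rw [bilBlk_add_left, bilBlk_add_right, bilBlk_add_right, bilBlk_comm (Pi.single e δ) a hM,
    bilBlk_single_single, bilBlk_single]
  ring

lemma bilBlk_self_convex (h0 : ∀ a : E → V, 0 ≤ bilBlk M a a) (hM : ∀ e e', M e e' = M e' e)
    {r : ℝ} (hr0 : 0 ≤ r) (hr1 : r ≤ 1) :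
    bilBlk M ((1 - r) • a + r • b) ((1 - r) • a + r • b) ≤
      (1 - r) * bilBlk M a a + r * bilBlk M b b := by
  have h := mul_nonneg (mul_nonneg hr0 (sub_nonneg.2 hr1)) (h0 (a - b))
  rw [bilBlk_sub_left, bilBlk_sub_right, bilBlk_sub_right, bilBlk_comm b a hM] at h
  rw [bilBlk_add_left, bilBlk_add_right, bilBlk_add_right]
  simp only [bilBlk_smul_left, bilBlk_smul_right, bilBlk_comm b a hM]
  linarith

lemma sum_inner_mulBlk (hM : ∀ e e', M e e' = M e' e) :
    ∑ e, inner ℝ (a e) (mulBlk M b e) = bilBlk M a b := by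
  rw [bilBlk_comm a b hM, bilBlk]
  exact Finset.sum_congr rfl fun e _ => real_inner_comm _ _

/-- The expected one-step decrease of the accelerated proximal coordinate gradient method, for the
quadratic part `H` and the seminorm `Q`; the non-smooth part enters through the numbers `Δ e` of the
proximal inequality. -/
lemma accelerated_step [DecidableEq E] {H Q : Matrix E E ℝ} {σ ρ : ℝ} {p Δ : E → ℝ}
    (hH : ∀ e e', H e e' = H e' e) (hQ : ∀ e e', Q e e' = Q e' e)
    (hHQ : H * Q = H) (hQ0 : ∀ e, 0 ≤ Q e e)
    (hQpos : ∀ a : E → V, 0 ≤ bilBlk Q a a)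
    (hsc : ∀ a : E → V, σ * bilBlk Q a a ≤ bilBlk H a a)
    (hp : ∀ e, 0 < p e) (hp1 : ∑ e, p e = 1) (hσ : 0 < σ) (hρ0 : 0 < ρ) (hρ1 : ρ ≤ 1)
    (hρ : ∀ e, ρ ^ 2 * (H e e * Q e e) ≤ σ * p e ^ 2)
    {ls x v y w vt : E → V} (hy : (1 + ρ) • y = x + ρ • v) (hw : w = (1 - ρ) • v + ρ • y)
    (hprox : ∀ e, inner ℝ (mulBlk Q (w - ls) e) (vt e - w e) + Q e e * ‖vt e - w e‖ ^ 2
      + ρ / (σ * p e) * (Q e e * inner ℝ (mulBlk H y e) (vt e - w e)) ≤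
      ρ / (σ * p e) * (inner ℝ (mulBlk H y e) (mulBlk Q (ls - w) e) + Δ e)) :
    ∑ e, p e * (σ / 2 * bilBlk Q (w + Pi.single e (vt e - w e) - ls)
        (w + Pi.single e (vt e - w e) - ls)
      + 1 / 2 * bilBlk H (y + (ρ * Q e e / p e) • (Pi.single e (vt e - w e) : E → V))
        (y + (ρ * Q e e / p e) • (Pi.single e (vt e - w e) : E → V))) ≤
      (1 - ρ) * (σ / 2 * bilBlk Q (v - ls) (v - ls) + 1 / 2 * bilBlk H x x)
      + ρ * (1 / 2 * bilBlk H ls ls) + ρ * ∑ e, Δ e := by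
  have hHpos : ∀ a : E → V, 0 ≤ bilBlk H a a := fun a =>
    (mul_nonneg hσ.le (hQpos a)).trans (hsc a)
  have hedge : ∀ e, p e * (σ / 2 * bilBlk Q (w + Pi.single e (vt e - w e) - ls)
        (w + Pi.single e (vt e - w e) - ls)
      + 1 / 2 * bilBlk H (y + (ρ * Q e e / p e) • (Pi.single e (vt e - w e) : E → V))
        (y + (ρ * Q e e / p e) • (Pi.single e (vt e - w e) : E → V))) ≤
      p e * (σ / 2 * bilBlk Q (w - ls) (w - ls) + 1 / 2 * bilBlk H y y)
      + ρ * (inner ℝ (mulBlk H y e) (mulBlk Q (ls - w) e) + Δ e) := by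
    intro e
    have hpe := hp e
    have h1 : w + Pi.single e (vt e - w e) - ls = (w - ls) + Pi.single e (vt e - w e) := by abel
    have h2 : (ρ * Q e e / p e) • (Pi.single e (vt e - w e) : E → V) =
        Pi.single e ((ρ * Q e e / p e) • (vt e - w e)) := by
      rw [Pi.single_smul]
    rw [h1, h2, bilBlk_self_add_single _ hQ, bilBlk_self_add_single _ hH, inner_smul_right,
      norm_smul, mul_pow, Real.norm_eq_abs, sq_abs]
    have h3 := mul_le_mul_of_nonneg_left (hprox e) (mul_pos hσ hpe).le
    -- The condition on ρ bounds the second-order term of H by that of Q. Half of each then adds up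
    -- to at most the single term σ Q_ee ‖vt e - w e‖² available in `hprox`.
    have h4 : p e * (H e e * ((ρ * Q e e / p e) ^ 2 * ‖vt e - w e‖ ^ 2)) ≤
        p e * (σ * (Q e e * ‖vt e - w e‖ ^ 2)) := by
      have h5 := mul_le_mul_of_nonneg_right (hρ e)
        (mul_nonneg (hQ0 e) (sq_nonneg ‖vt e - w e‖))
      have h6 : p e * (H e e * ((ρ * Q e e / p e) ^ 2 * ‖vt e - w e‖ ^ 2)) =
          (ρ ^ 2 * (H e e * Q e e) * (Q e e * ‖vt e - w e‖ ^ 2)) / p e := by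
        field_simp
      rw [h6, div_le_iff₀ hpe]
      refine h5.trans_eq ?_
      ring
    have h7 : σ * p e * (ρ / (σ * p e) * (inner ℝ (mulBlk H y e) (mulBlk Q (ls - w) e) + Δ e)) =
        ρ * (inner ℝ (mulBlk H y e) (mulBlk Q (ls - w) e) + Δ e) := by
      field_simp
    have h8 : σ * p e * (inner ℝ (mulBlk Q (w - ls) e) (vt e - w e) + Q e e * ‖vt e - w e‖ ^ 2
        + ρ / (σ * p e) * (Q e e * inner ℝ (mulBlk H y e) (vt e - w e))) =
        p e * (σ * inner ℝ (mulBlk Q (w - ls) e) (vt e - w e))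
          + p e * (σ * (Q e e * ‖vt e - w e‖ ^ 2))
          + p e * (ρ * Q e e / p e * inner ℝ (mulBlk H y e) (vt e - w e)) := by
      field_simp
    rw [h7, h8] at h3
    linarith
  have hsum := Finset.sum_le_sum fun e (_ : e ∈ Finset.univ) => hedge e
  rw [Finset.sum_add_distrib, ← Finset.sum_mul, hp1, one_mul, ← Finset.mul_sum,
    Finset.sum_add_distrib, sum_inner_mulBlk _ _ hQ] at hsum
  have hQH : Q * H = H := by
    ext e e'
    have := congrFun (congrFun hHQ e') e
    rw [Matrix.mul_apply] at this ⊢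
    rw [hH e e', ← this]
    exact Finset.sum_congr rfl fun e'' _ => by rw [hQ e e'', hH e'' e', mul_comm]
  -- Dividing by p_e in the step size makes the sum over edges deterministic. As Q H = H, the
  -- projection then disappears from the linear term.
  have hbil : bilBlk Q (mulBlk H y) (ls - w) = bilBlk H y (ls - w) := by
    rw [bilBlk, mulBlk_mulBlk, hQH, bilBlk]
  rw [hbil] at hsum
  refine hsum.trans ?_
  have hwls : w - ls = (1 - ρ) • (v - ls) + ρ • (y - ls) := by rw [hw]; module
  have hconv := bilBlk_self_convex (v - ls) (y - ls) hQpos hQ hρ0.le hρ1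
  rw [← hwls] at hconv
  have hls : bilBlk H ls ls = bilBlk H y y + 2 * bilBlk H y (ls - y)
      + bilBlk H (y - ls) (y - ls) := by
    simp only [bilBlk_sub_left, bilBlk_sub_right, bilBlk_comm ls y hH]
    ring
  have hx : bilBlk H x x = bilBlk H y y + 2 * bilBlk H y (x - y)
      + bilBlk H (x - y) (x - y) := by
    simp only [bilBlk_sub_left, bilBlk_sub_right, bilBlk_comm x y hH]
    ring
  -- The definitions of y and w give ρ w = y - (1 - ρ) x. This splits the linear term into one part
  -- compared with the optimum and one compared with x.
  have hlin : ρ * bilBlk H y (ls - w) = ρ * bilBlk H y (ls - y)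
      + (1 - ρ) * bilBlk H y (x - y) := by
    have h1 : ρ • (ls - w) = ρ • (ls - y) + (1 - ρ) • (x - y) := by
      have h2 : x = (1 + ρ) • y - ρ • v := by rw [hy]; abel
      rw [h2, hw]
      module
    rw [← bilBlk_smul_right, h1, bilBlk_add_right, bilBlk_smul_right, bilBlk_smul_right]
  have h1 := mul_le_mul_of_nonneg_left hconv (half_pos hσ).le
  have h2 := mul_le_mul_of_nonneg_left (hsc (y - ls)) (half_pos hρ0).le
  have h3 := mul_nonneg (sub_nonneg.2 hρ1) (hHpos (x - y))
  rw [mul_add, hlin, hls, hx]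
  nlinarith

/-- Block forms decouple over the d coordinates, so scalar matrix inequalities carry over to blocks.
-/
lemma bilBlk_eq_sum_dotProduct {d : ℕ} (M : Matrix E E ℝ) (a : E → Vec d) :
    bilBlk M a a = ∑ l, (fun e => a e l) ⬝ᵥ (M *ᵥ fun e => a e l) := by
  simp only [bilBlk_eq, PiLp.inner_apply, RCLike.inner_apply, conj_trivial, dotProduct,
    Matrix.mulVec, Finset.mul_sum]
  rw [Finset.sum_comm' (t' := Finset.univ) (s' := fun _ => Finset.univ) (by simp)]
  conv_rhs => rw [Finset.sum_comm]
  rw [Finset.sum_comm]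
  refine Finset.sum_congr rfl fun e _ => ?_
  rw [Finset.sum_comm]
  exact Finset.sum_congr rfl fun l _ => Finset.sum_congr rfl fun e' _ => by ring

end Blocks

/-! ### The seminorm of `A† A` on dual variables. -/

namespace Problem

variable {n m d : ℕ} (P : Problem n m d) {K : ℕ}

lemma sigmaA_mul_bilBlk_le (hn : 0 < n) (a : Edge n m K → Vec d) :
    P.sigmaA K * bilBlk (pinvProj (P.incidence K)) a a ≤ bilBlk (P.hessian K) a a := by
  rw [bilBlk_eq_sum_dotProduct, bilBlk_eq_sum_dotProduct, Finset.mul_sum]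
  exact Finset.sum_le_sum fun l _ => P.sigmaA_mul_le hn _

lemma bilBlk_pinvProj_eq (a : Edge n m K → Vec d) :
    bilBlk (pinvProj (P.incidence K)) a a =
      ∑ e, ‖mulBlk (pinvProj (P.incidence K)) a e‖ ^ 2 := by
  have h : mulBlk (pinvProj (P.incidence K)) a =
      mulBlk (pinvProj (P.incidence K)) (mulBlk (pinvProj (P.incidence K)) a) := by
    rw [mulBlk_mulBlk, pinvProj_mul_self]
  rw [← sum_inner_mulBlk a a (pinvProj_comm _), h, sum_inner_mulBlk _ _ (pinvProj_comm _), bilBlk]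
  exact Finset.sum_congr rfl fun e _ => by rw [← h, real_inner_self_eq_norm_sq]

lemma bilBlk_pinvProj_nonneg (a : Edge n m K → Vec d) :
    0 ≤ bilBlk (pinvProj (P.incidence K)) a a := by
  rw [bilBlk_pinvProj_eq]
  exact Finset.sum_nonneg fun e _ => sq_nonneg _

/-- `A λ` is controlled by the seminorm of `A† A`. -/
lemma norm_applyA_sq_le (a : Edge n m K → Vec d) (v : Vertex n m K) :
    ‖P.applyA K a v‖ ^ 2 ≤ (∑ e, P.incidence K v e ^ 2) *
      bilBlk (pinvProj (P.incidence K)) a a := by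
  -- Since A = A (A†A), only the projected part of a enters; Cauchy–Schwarz does the rest.
  have h : P.applyA K a v =
      ∑ e, P.incidence K v e • mulBlk (pinvProj (P.incidence K)) a e := by
    simp only [applyA, mulBlk, Finset.smul_sum, smul_smul]
    rw [Finset.sum_comm]
    refine Finset.sum_congr rfl fun e _ => ?_
    rw [← Finset.sum_smul, ← Matrix.mul_apply, mul_pinvProj]
  rw [h, bilBlk_pinvProj_eq]
  calc ‖∑ e, P.incidence K v e • mulBlk (pinvProj (P.incidence K)) a e‖ ^ 2
      ≤ (∑ e, |P.incidence K v e| * ‖mulBlk (pinvProj (P.incidence K)) a e‖) ^ 2 := by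
        gcongr
        refine (norm_sum_le _ _).trans_eq ?_
        simp [norm_smul]
    _ ≤ _ := by
        refine (Finset.sum_mul_sq_le_sq_mul_sq _ _ _).trans_eq ?_
        simp [sq_abs]

end Problem

namespace Problem

variable {n m d : ℕ} (P : Problem n m d) {K : ℕ}

/-! ### Sampling probabilities and the size of ρ. -/

section Sampling

lemma rate_ratio_pos (hn : 0 < n) (hm : 0 < m) :
    0 < √(2 * P.kappaS K) / (m + √(m * P.kappaS K)) := by
  have hk := P.kappaS_pos (K := K) hn
  have hm' : (0 : ℝ) < m := by exact_mod_cast hm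
  have : 0 < √(2 * P.kappaS K) := Real.sqrt_pos.2 (by positivity)
  positivity

lemma pComp_pos (hn : 0 < n) (hm : 0 < m) : 0 < P.pComp K := by
  have := P.rate_ratio_pos (K := K) hn hm
  unfold pComp
  positivity

lemma pComm_eq (hn : 0 < n) (hm : 0 < m) :
    P.pComm K = P.pComp K * (√(2 * P.kappaS K) / (m + √(m * P.kappaS K))) := by
  have := P.rate_ratio_pos (K := K) hn hm
  unfold pComm pComp
  field_simp
  ring

lemma pComm_pos (hn : 0 < n) (hm : 0 < m) : 0 < P.pComm K := by
  rw [P.pComm_eq hn hm]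
  exact mul_pos (P.pComp_pos hn hm) (P.rate_ratio_pos hn hm)

lemma sum_sqrt_pos (hn : 0 < n) (hm : 0 < m) (i : Fin n) :
    0 < ∑ j : Fin m, √(1 + P.L i j / P.sigmaT K) := by
  have : Nonempty (Fin m) := ⟨⟨0, hm⟩⟩
  refine Finset.sum_pos (fun j _ => Real.sqrt_pos.2 ?_) Finset.univ_nonempty
  have := div_pos (P.L_pos i j) (P.sigmaT_pos (K := K) hn)
  linarith

lemma prob_pos (hn : 0 < n) (hm : 0 < m) (hK : 0 < K) (e : Edge n m K) : 0 < P.prob K e := by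
  have hn' : (0 : ℝ) < n := by exact_mod_cast hn
  have hK' : (0 : ℝ) < K := by exact_mod_cast hK
  rcases e with ⟨i, k⟩ | ⟨i, j⟩
  · exact div_pos (P.pComm_pos hn hm) (mul_pos hn' hK')
  · have h1 := div_pos (P.L_pos i j) (P.sigmaT_pos (K := K) hn)
    exact mul_pos (div_pos (P.pComp_pos hn hm) hn')
      (div_pos (Real.sqrt_pos.2 (by linarith)) (P.sum_sqrt_pos hn hm i))

lemma sum_prob_comp (hn : 0 < n) (hm : 0 < m) (i : Fin n) :
    ∑ j, P.prob K (Sum.inr (i, j)) = P.pComp K / n := by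
  simp only [prob]
  rw [← Finset.mul_sum, ← Finset.sum_div, div_self (P.sum_sqrt_pos hn hm i).ne', mul_one]

lemma sum_prob (hn : 0 < n) (hm : 0 < m) (hK : 0 < K) : ∑ e, P.prob K e = 1 := by
  have hn' : (n : ℝ) ≠ 0 := by exact_mod_cast hn.ne'
  have hK' : (K : ℝ) ≠ 0 := by exact_mod_cast hK.ne'
  rw [Fintype.sum_sum_type, Fintype.sum_prod_type, Fintype.sum_prod_type]
  simp only [P.sum_prob_comp hn hm]
  simp only [prob, Finset.sum_const, Finset.card_univ, Fintype.card_fin, nsmul_eq_mul]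
  unfold pComm
  field_simp
  ring

lemma rho_sq_mul_le (hn : 0 < n) (hK : 0 < K) (hKn : K ≤ n) (e : Edge n m K) :
    0 ≤ P.rho K ∧ P.rho K ^ 2 * (P.hessian K e e * P.R K e) ≤ P.sigmaA K * P.prob K e ^ 2 := by
  have h0 : 0 ≤ P.rho K := Real.iInf_nonneg fun e => Real.sqrt_nonneg _
  refine ⟨h0, ?_⟩
  have h1 : P.rho K ≤ √(P.sigmaA K / ((P.Sig K e.src)⁻¹ + (P.Sig K e.dst)⁻¹) *
      (P.prob K e ^ 2 / (P.weight K e ^ 2 * P.R K e))) :=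
    ciInf_le (Set.finite_range _).bddBelow e
  have hw := P.weight_pos hn hK e
  have hR := P.R_pos hn hK e
  have hs := inv_pos.2 (P.Sig_pos hn e.src)
  have hd := inv_pos.2 (P.Sig_pos hn e.dst)
  have hA := P.sigmaA_pos hn hK hKn
  have h2 := pow_le_pow_left₀ h0 h1 2
  rw [Real.sq_sqrt (by positivity), div_mul_div_comm, le_div_iff₀ (by positivity)] at h2
  rw [hessian_apply_self]
  refine le_trans (le_of_eq ?_) h2
  ring

lemma rho_pos (hn : 0 < n) (hm : 0 < m) (hK : 0 < K) (hKn : K ≤ n) : 0 < P.rho K := by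
  have : Nonempty (Edge n m K) := ⟨Sum.inl (⟨0, hn⟩, ⟨0, hK⟩)⟩
  obtain ⟨e, he⟩ := exists_eq_ciInf_of_finite (f := fun e : Edge n m K =>
    √(P.sigmaA K / ((P.Sig K e.src)⁻¹ + (P.Sig K e.dst)⁻¹) *
      (P.prob K e ^ 2 / (P.weight K e ^ 2 * P.R K e))))
  rw [rho, ← he, Real.sqrt_pos]
  have hw := P.weight_pos hn hK e
  have hR := P.R_pos hn hK e
  have hs := inv_pos.2 (P.Sig_pos hn e.src)
  have hd := inv_pos.2 (P.Sig_pos hn e.dst)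
  have hA := P.sigmaA_pos hn hK hKn
  have hp := P.prob_pos hn hm hK e
  positivity

/-- Strong convexity tested on a single computation edge, where R_e = 1, gives σ_A ≤ H_ee. The
defining bound on ρ then reads ρ² H_ee ≤ H_ee p_e². This makes τ = ρ / p_e ≤ 1 a valid convex
weight. -/
lemma rho_le_prob_comp (hn : 0 < n) (hm : 0 < m) (hK : 0 < K) (hKn : K ≤ n)
    (i : Fin n) (j : Fin m) : P.rho K ≤ P.prob K (Sum.inr (i, j)) := by
  obtain ⟨h0, h1⟩ := P.rho_sq_mul_le hn hK hKn (Sum.inr (i, j))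
  rw [P.R_comp hn hK, mul_one] at h1
  have h2 := P.sigmaA_mul_le (K := K) hn (Pi.single (Sum.inr (i, j)) 1)
  simp [P.pinvProj_comp hn hK] at h2
  have h3 := P.hessian_apply_self_pos hn hK (Sum.inr (i, j))
  refine (sq_le_sq₀ h0 (P.prob_pos hn hm hK _).le).1 ?_
  refine le_of_mul_le_mul_right ?_ h3
  refine h1.trans ?_
  rw [mul_comm]
  exact mul_le_mul_of_nonneg_left h2 (sq_nonneg _)

lemma rho_le_one (hn : 0 < n) (hm : 0 < m) (hK : 0 < K) (hKn : K ≤ n) : P.rho K ≤ 1 := by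
  refine (P.rho_le_prob_comp hn hm hK hKn ⟨0, hn⟩ ⟨0, hm⟩).trans ?_
  rw [← P.sum_prob hn hm hK]
  exact Finset.single_le_sum (fun e _ => (P.prob_pos hn hm hK e).le) (Finset.mem_univ _)

end Sampling

/-! ### The dual optimum and its optimality conditions. -/

section DualOptimum

lemma sum_gradient_add_eq_zero {θs : Vec d} (h : IsMinOn P.objective Set.univ θs) :
    ∑ i, ∑ j, gradient (P.f i j) θs + (n * P.σ) • θs = 0 := by
  have hmin : IsLocalMin P.objective θs := h.isLocalMin Filter.univ_mem
  have hg : ∀ i, HasFDerivAt (fun θ => ∑ j, P.f i j θ + P.σ / 2 * ‖θ‖ ^ 2)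
      (∑ j, InnerProductSpace.toDual ℝ (Vec d) (gradient (P.f i j) θs)
        + (P.σ / 2) • (2 • innerSL ℝ θs)) θs := by
    intro i
    refine HasFDerivAt.add ?_ ?_
    · refine HasFDerivAt.fun_sum fun j _ => ?_
      exact (P.differentiable i j θs).hasGradientAt.hasFDerivAt
    · exact (hasStrictFDerivAt_norm_sq θs).hasFDerivAt.const_mul (P.σ / 2)
  have hobj : HasFDerivAt P.objective (∑ i : Fin n,
      (∑ j, InnerProductSpace.toDual ℝ (Vec d) (gradient (P.f i j) θs)
        + (P.σ / 2) • (2 • innerSL ℝ θs))) θs := HasFDerivAt.fun_sum fun i _ => hg i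
  have h0 := hmin.hasFDerivAt_eq_zero hobj
  refine ext_inner_right ℝ fun z => ?_
  have h1 := congrArg (fun T => T z) h0
  simp only [Finset.sum_add_distrib, Finset.sum_const, Finset.card_univ, Fintype.card_fin,
    add_apply, sum_apply, smul_apply,
    InnerProductSpace.toDual_apply_apply, innerSL_apply_apply, zero_apply,
    smul_eq_mul, nsmul_eq_mul, Nat.cast_ofNat] at h1
  rw [inner_add_left, inner_zero_left, inner_smul_left, sum_inner]
  simp only [sum_inner, conj_trivial]
  rw [← h1]
  ring

variable (K) in
/-- A dual optimum, given the primal optimum. -/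
def dualOpt (θs : Vec d) : Edge n m K → Vec d
  | Sum.inl (i, _) => (K : ℝ)⁻¹ • (P.sigmaT K • θs + ∑ j, gradient (P.f i j) θs)
  | Sum.inr (i, j) => (P.weight K (Sum.inr (i, j)))⁻¹ • gradient (P.f i j) θs

lemma applyA_dualOpt_comp (hn : 0 < n) (hK : 0 < K) (θs : Vec d) (i : Fin n) (j : Fin m) :
    P.applyA K (P.dualOpt K θs) (Vertex.comp i j) = gradient (P.f i j) θs := by
  rw [applyA, sum_incidence_smul_comp]
  exact smul_inv_smul₀ (P.weight_pos hn hK _).ne' _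

lemma applyA_dualOpt_node (hn : 0 < n) (hK : 0 < K) (θs : Vec d) (i : Fin n) :
    P.applyA K (P.dualOpt K θs) (Vertex.node i) = P.sigmaT K • θs := by
  have hK' : (K : ℝ) ≠ 0 := by exact_mod_cast hK.ne'
  rw [applyA, sum_incidence_smul_node]
  have h : ∀ j, P.weight K (Sum.inr (i, j)) • P.dualOpt K θs (Sum.inr (i, j)) =
      gradient (P.f i j) θs := fun j => smul_inv_smul₀ (P.weight_pos hn hK _).ne' _
  simp only [h]
  simp only [dualOpt, Finset.sum_const, Finset.card_univ, Fintype.card_fin]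
  rw [← Nat.cast_smul_eq_nsmul ℝ, smul_inv_smul₀ hK', add_sub_cancel_right]

/-- By primal optimality the gradients sum to -n σ θ⋆, so the token receives K⁻¹ (n σ - n σ̃) θ⋆.
This is σ̃ θ⋆ because (n + K) σ̃ = n σ, which is why σ is rescaled to σ̃. -/
lemma applyA_dualOpt_token (hn : 0 < n) (hK : 0 < K) {θs : Vec d}
    (hθ : IsMinOn P.objective Set.univ θs) (k : Fin K) :
    P.applyA K (P.dualOpt K θs) (Vertex.token k) = P.sigmaT K • θs := by
  have hK' : (K : ℝ) ≠ 0 := by exact_mod_cast hK.ne'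
  have hn' : (0 : ℝ) < n := by exact_mod_cast hn
  have hK'' : (0 : ℝ) < K := by exact_mod_cast hK
  rw [applyA, sum_incidence_smul_token]
  simp only [dualOpt]
  rw [← Finset.smul_sum, Finset.sum_add_distrib,
    eq_neg_of_add_eq_zero_left (P.sum_gradient_add_eq_zero hθ)]
  simp only [Finset.sum_const, Finset.card_univ, Fintype.card_fin]
  rw [← Nat.cast_smul_eq_nsmul ℝ]
  unfold sigmaT
  match_scalars
  field_simp
  ring

/-- A gradient block sees only the two endpoints of its edge, so consensus of Σ⁻¹Aλ makes the
communication blocks vanish. -/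
lemma mulBlk_hessian (a : Edge n m K → Vec d) (e : Edge n m K) :
    mulBlk (P.hessian K) a e = P.weight K e • ((P.Sig K e.src)⁻¹ • P.applyA K a e.src
      - (P.Sig K e.dst)⁻¹ • P.applyA K a e.dst) := by
  have h : mulBlk (P.hessian K) a e =
      ∑ v, (P.incidence K v e * (P.Sig K v)⁻¹) • P.applyA K a v := by
    have hH : ∀ e', P.hessian K e e' =
        ∑ v, P.incidence K v e * (P.Sig K v)⁻¹ * P.incidence K v e' := by
      intro e'
      rw [hessian, Matrix.mul_apply]
      simp only [Matrix.mul_diagonal, Matrix.transpose_apply]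
    simp only [mulBlk, hH, applyA, Finset.smul_sum, Finset.sum_smul, smul_smul]
    exact Finset.sum_comm
  rw [h]
  simp only [incidence, mul_sub, sub_mul, sub_smul, Finset.sum_sub_distrib, mul_ite, mul_one,
    mul_zero, ite_mul, zero_mul, ite_smul, zero_smul, Finset.sum_ite_eq',
    Finset.mem_univ, if_true, smul_sub, smul_smul]

lemma isSupAffine_psi (e : Edge n m K) : IsSupAffine (P.psi (d := d) K e) := by
  rcases e with ⟨i, k⟩ | ⟨i, j⟩
  · exact IsSupAffine.zero
  · exact isSupAffine_conj_sub (P.L_pos i j) (P.differentiable i j) (P.smooth i j) _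

lemma psi_comm (i : Fin n) (k : Fin K) (u : Vec d) : P.psi K (Sum.inl (i, k)) u = 0 := rfl

/-- Optimality of the dual point. -/
lemma dualOpt_subgradient (hn : 0 < n) (hK : 0 < K) {θs : Vec d}
    (hθ : IsMinOn P.objective Set.univ θs) (e : Edge n m K) :
    P.psi K e (P.dualOpt K θs e) ≠ ⊤ ∧ ∀ u, P.psi K e u ≠ ⊤ →
      (P.psi K e (P.dualOpt K θs e)).toReal
        - inner ℝ (mulBlk (P.hessian K) (P.dualOpt K θs) e) (u - P.dualOpt K θs e) ≤
      (P.psi K e u).toReal := by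
  have hs := P.sigmaT_pos (K := K) hn
  rcases e with ⟨i, k⟩ | ⟨i, j⟩
  · have h0 : mulBlk (P.hessian K) (P.dualOpt K θs) (Sum.inl (i, k)) = 0 := by
      rw [mulBlk_hessian]
      simp only [Edge.src, Edge.dst]
      rw [P.applyA_dualOpt_node hn hK, P.applyA_dualOpt_token hn hK hθ]
      simp [Sig, Vertex.node, Vertex.token]
    simp [psi_comm, h0]
  · have hw := P.weight_pos hn hK (Sum.inr (i, j))
    have hL := P.L_pos i j
    have hu0 : P.weight K (Sum.inr (i, j)) • P.dualOpt K θs (Sum.inr (i, j)) =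
      gradient (P.f i j) θs := smul_inv_smul₀ hw.ne' _
    obtain ⟨h1, h2⟩ := conj_sub_subgradient (P.L_pos i j) (P.differentiable i j) (P.convex i j)
      (P.smooth i j) θs (P.dualOpt K θs (Sum.inr (i, j))) hu0
    refine ⟨h1, fun u hu => ?_⟩
    have h3 := h2 u hu
    have hg : mulBlk (P.hessian K) (P.dualOpt K θs) (Sum.inr (i, j)) =
        -(P.weight K (Sum.inr (i, j)) • θs
          - (P.weight K (Sum.inr (i, j)) ^ 2 / P.L i j) • P.dualOpt K θs (Sum.inr (i, j))) := by
      rw [mulBlk_hessian]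
      simp only [Edge.src, Edge.dst]
      rw [P.applyA_dualOpt_node hn hK, P.applyA_dualOpt_comp hn hK, ← hu0]
      simp only [Sig, Vertex.node, Vertex.comp]
      match_scalars <;> field_simp
    rw [hg, inner_neg_left, sub_neg_eq_add]
    exact h3

end DualOptimum

end Problem

/-! ### Convex-combination bookkeeping for the non-smooth part. -/

section AveragedPoints

variable {V : Type*} [AddCommGroup V] [Module ℝ V]

/-- The update of the auxiliary point `r` in the representation `x = τ v + (1 - τ) r`. -/
def auxUpdate (ρ τ : ℝ) (v r : V) : V :=
  (ρ * (1 + τ) / (1 + ρ)) • v + ((1 - τ * ρ) / (1 + ρ)) • r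

/-- The new auxiliary point is designed to satisfy (1 - τ) r⁺ = y - τ w when x = τ v + (1 - τ) r.
The definition by nonnegative weights also makes sense for τ = 1. -/
lemma auxUpdate_smul {ρ : ℝ} (hρ : 0 < ρ) (τ : ℝ) (v r : V) :
    (1 - τ) • auxUpdate ρ τ v r =
      (1 + ρ)⁻¹ • ((τ • v + (1 - τ) • r) + ρ • v)
        - τ • ((1 - ρ) • v + ρ • (1 + ρ)⁻¹ • ((τ • v + (1 - τ) • r) + ρ • v)) := by
  have : 1 + ρ ≠ 0 := by positivity
  unfold auxUpdate
  match_scalars <;> field_simp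
  all_goals ring

lemma averaged_eq {ρ : ℝ} (hρ : 0 < ρ) (τ : ℝ) (v r : V) :
    (1 - ρ) • v + ρ • (1 + ρ)⁻¹ • ((τ • v + (1 - τ) • r) + ρ • v) =
      ((1 + ρ * τ) / (1 + ρ)) • v + (ρ * (1 - τ) / (1 + ρ)) • r := by
  have : 1 + ρ ≠ 0 := by positivity
  match_scalars <;> field_simp
  ring

end AveragedPoints

section

variable {V : Type*} [NormedAddCommGroup V] [InnerProductSpace ℝ V] {Ψ : V → EReal}

lemma IsSupAffine.averaged_ne_top (h : IsSupAffine Ψ) {v r : V} (hv : Ψ v ≠ ⊤) (hr : Ψ r ≠ ⊤)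
    {ρ τ : ℝ} (hρ : 0 < ρ) (hτ0 : 0 ≤ τ) (hτ : τ ≤ 1) :
    Ψ (((1 + ρ * τ) / (1 + ρ)) • v + (ρ * (1 - τ) / (1 + ρ)) • r) ≠ ⊤ ∧
    (Ψ (((1 + ρ * τ) / (1 + ρ)) • v + (ρ * (1 - τ) / (1 + ρ)) • r)).toReal ≤
      (1 + ρ * τ) / (1 + ρ) * (Ψ v).toReal + ρ * (1 - τ) / (1 + ρ) * (Ψ r).toReal := by
  have h1 : 0 ≤ 1 - τ := sub_nonneg.2 hτ
  refine h.convex hv hr (by positivity) (by positivity) ?_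
  field_simp
  ring

lemma IsSupAffine.auxUpdate_ne_top (h : IsSupAffine Ψ) {v r : V} (hv : Ψ v ≠ ⊤) (hr : Ψ r ≠ ⊤)
    {ρ τ : ℝ} (hρ : 0 < ρ) (hρ1 : ρ ≤ 1) (hτ0 : 0 ≤ τ) (hτ : τ ≤ 1) :
    Ψ (auxUpdate ρ τ v r) ≠ ⊤ ∧ (Ψ (auxUpdate ρ τ v r)).toReal ≤
      ρ * (1 + τ) / (1 + ρ) * (Ψ v).toReal + (1 - τ * ρ) / (1 + ρ) * (Ψ r).toReal := by
  have h1 : 0 ≤ 1 - τ * ρ := sub_nonneg.2 (mul_le_one₀ hτ hρ.le hρ1)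
  refine h.convex hv hr (by positivity) (by positivity) ?_
  field_simp
  ring

/-- Behind it lies the identity (τ - ρ) w + (1 - τ) r⁺ = (1 - ρ) x. Convexity is applied to w and r⁺
as combinations of v and r, and the coefficients add up exactly; ρ ≤ τ keeps the weight of w
nonnegative. -/
lemma IsSupAffine.averaged_add_auxUpdate_le (h : IsSupAffine Ψ) {v r : V} (hv : Ψ v ≠ ⊤)
    (hr : Ψ r ≠ ⊤) {ρ τ : ℝ} (hρ : 0 < ρ) (hρτ : ρ ≤ τ) (hτ : τ ≤ 1) :
    (τ - ρ) * (Ψ (((1 + ρ * τ) / (1 + ρ)) • v + (ρ * (1 - τ) / (1 + ρ)) • r)).toReal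
      + (1 - τ) * (Ψ (auxUpdate ρ τ v r)).toReal ≤
      (1 - ρ) * (τ * (Ψ v).toReal + (1 - τ) * (Ψ r).toReal) := by
  have h1 := mul_le_mul_of_nonneg_left
    (h.averaged_ne_top hv hr hρ (hρ.le.trans hρτ) hτ).2 (sub_nonneg.2 hρτ)
  have h2 := mul_le_mul_of_nonneg_left
    (h.auxUpdate_ne_top hv hr hρ (hρτ.trans hτ) (hρ.le.trans hρτ) hτ).2 (sub_nonneg.2 hτ)
  refine (add_le_add h1 h2).trans (le_of_eq ?_)
  field_simp
  ring

end

/-! ### The Lyapunov function and its contraction. -/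

namespace Problem

variable {n m d : ℕ} (P : Problem n m d) {K : ℕ}

/-- The extrapolated point `y_t`. -/
def midY (s : State n m d K) : Edge n m K → Vec d := (1 + P.rho K)⁻¹ • (s.x + P.rho K • s.v)

/-- The averaged point `w_t`. -/
def midW (s : State n m d K) : Edge n m K → Vec d :=
  (1 - P.rho K) • s.v + P.rho K • P.midY s

/-- The proximal point for every edge. -/
def proxPoint (s : State n m d K) (e : Edge n m K) : Vec d :=
  argmin (proxObjective (P.psi K e) (P.midW s e) (mulBlk (P.hessian K) (P.midY s) e)
    (P.rho K / (P.sigmaA K * P.prob K e)))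

lemma step_v (s : State n m d K) (e : Edge n m K) :
    (P.step K s e).v = Function.update (P.midW s) e (P.proxPoint s e) := rfl

lemma update_eq_add_single (w : Edge n m K → Vec d) (e : Edge n m K) (u : Vec d) :
    Function.update w e u = w + Pi.single e (u - w e) := by
  ext1 e'
  by_cases h : e' = e
  · subst h; simp
  · simp [h]

lemma step_x (s : State n m d K) (e : Edge n m K) :
    (P.step K s e).x = P.midY s + (P.rho K * P.R K e / P.prob K e) •
      (Pi.single e (P.proxPoint s e - P.midW s e) : Edge n m K → Vec d) := by
  have h : (P.step K s e).x = P.midY s + (P.rho K * P.R K e / P.prob K e) •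
      (Function.update (P.midW s) e (P.proxPoint s e) - P.midW s) := rfl
  rw [h, update_eq_add_single, add_sub_cancel_left]

variable (K) in
/-- The momentum ratio `ρ / p_e`. -/
def tau (e : Edge n m K) : ℝ := P.rho K / P.prob K e

/-- The invariant of the iterates `(x, v)` together with auxiliary points `r`. -/
structure Admissible (s : State n m d K) (r : Edge n m K → Vec d) : Prop where
  v_ne_top : ∀ e, P.psi K e (s.v e) ≠ ⊤
  r_ne_top : ∀ e, P.psi K e (r e) ≠ ⊤
  x_eq : ∀ i j, s.x (Sum.inr (i, j)) = P.tau K (Sum.inr (i, j)) • s.v (Sum.inr (i, j))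
    + (1 - P.tau K (Sum.inr (i, j))) • r (Sum.inr (i, j))

/-- The auxiliary points after one step. -/
def auxStep (s : State n m d K) (r : Edge n m K → Vec d) (e : Edge n m K) : Vec d :=
  auxUpdate (P.rho K) (P.tau K e) (s.v e) (r e)

variable {s : State n m d K} {r : Edge n m K → Vec d}

lemma proxPoint_spec (hn : 0 < n) (hm : 0 < m) (hK : 0 < K) (hKn : K ≤ n)
    (hv : ∀ e, P.psi K e (s.v e) ≠ ⊤) (e : Edge n m K) (u' : Vec d) :
    proxObjective (P.psi K e) (P.midW s e) (mulBlk (P.hessian K) (P.midY s) e)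
      (P.rho K / (P.sigmaA K * P.prob K e)) (P.proxPoint s e) ≤
    proxObjective (P.psi K e) (P.midW s e) (mulBlk (P.hessian K) (P.midY s) e)
      (P.rho K / (P.sigmaA K * P.prob K e)) u' := by
  have hc : 0 < P.rho K / (P.sigmaA K * P.prob K e) :=
    div_pos (P.rho_pos hn hm hK hKn) (mul_pos (P.sigmaA_pos hn hK hKn) (P.prob_pos hn hm hK e))
  exact Classical.epsilon_spec
    (exists_forall_proxObjective_le (P.isSupAffine_psi e) (hv e) _ _ hc) u'

lemma tau_comp_mem (hn : 0 < n) (hm : 0 < m) (hK : 0 < K) (hKn : K ≤ n) (i : Fin n) (j : Fin m) :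
    P.rho K ≤ P.tau K (Sum.inr (i, j)) ∧ P.tau K (Sum.inr (i, j)) ≤ 1 := by
  have hp := P.prob_pos hn hm hK (Sum.inr (i, j))
  have hp1 : P.prob K (Sum.inr (i, j)) ≤ 1 := by
    rw [← P.sum_prob hn hm hK]
    exact Finset.single_le_sum (fun e _ => (P.prob_pos hn hm hK e).le) (Finset.mem_univ _)
  have hρ := P.rho_pos hn hm hK hKn
  unfold tau
  refine ⟨?_, (div_le_one hp).2 (P.rho_le_prob_comp hn hm hK hKn i j)⟩
  rw [le_div_iff₀ hp]
  exact mul_le_of_le_one_right hρ.le hp1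

lemma Admissible.midW_comp {P : Problem n m d} (h : P.Admissible s r) (hρ : 0 < P.rho K)
    (i : Fin n) (j : Fin m) :
    P.midW s (Sum.inr (i, j)) =
      ((1 + P.rho K * P.tau K (Sum.inr (i, j))) / (1 + P.rho K)) • s.v (Sum.inr (i, j))
      + (P.rho K * (1 - P.tau K (Sum.inr (i, j))) / (1 + P.rho K)) • r (Sum.inr (i, j)) := by
  rw [← averaged_eq hρ, ← h.x_eq]
  rfl

lemma Admissible.midW_ne_top {P : Problem n m d} (h : P.Admissible s r) (hn : 0 < n) (hm : 0 < m)
    (hK : 0 < K) (hKn : K ≤ n) (e : Edge n m K) : P.psi K e (P.midW s e) ≠ ⊤ := by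
  rcases e with ⟨i, k⟩ | ⟨i, j⟩
  · simp [psi_comm]
  · have hρ := P.rho_pos hn hm hK hKn
    obtain ⟨h1, h2⟩ := P.tau_comp_mem hn hm hK hKn i j
    rw [h.midW_comp hρ]
    exact ((P.isSupAffine_psi _).averaged_ne_top (h.v_ne_top _) (h.r_ne_top _) hρ
      (hρ.le.trans h1) h2).1

lemma Admissible.proxPoint_ne_top {P : Problem n m d} (h : P.Admissible s r) (hn : 0 < n)
    (hm : 0 < m) (hK : 0 < K) (hKn : K ≤ n) (e : Edge n m K) :
    P.psi K e (P.proxPoint s e) ≠ ⊤ := by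
  have hc : 0 < P.rho K / (P.sigmaA K * P.prob K e) :=
    div_pos (P.rho_pos hn hm hK hKn) (mul_pos (P.sigmaA_pos hn hK hKn) (P.prob_pos hn hm hK e))
  exact (three_point (P.isSupAffine_psi e) hc (P.proxPoint_spec hn hm hK hKn h.v_ne_top e)
    (h.v_ne_top e)).1

/-- On a computation edge R_e = 1, so x moves by τ (v⁺ - w) if the edge is drawn, while x⁺ = y and
v⁺ = w otherwise. In both cases x⁺ = y + τ (v⁺ - w) = τ v⁺ + (1 - τ) r⁺, with the same r⁺. -/
lemma Admissible.step {P : Problem n m d} (h : P.Admissible s r) (hn : 0 < n) (hm : 0 < m)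
    (hK : 0 < K) (hKn : K ≤ n) (e : Edge n m K) :
    P.Admissible (P.step K s e) (P.auxStep s r) := by
  have hρ := P.rho_pos hn hm hK hKn
  refine ⟨fun e' => ?_, fun e' => ?_, fun i j => ?_⟩
  · rw [step_v]
    by_cases he : e' = e
    · subst he
      rw [Function.update_self]
      exact h.proxPoint_ne_top hn hm hK hKn e'
    · rw [Function.update_of_ne he]
      exact h.midW_ne_top hn hm hK hKn e'
  · rcases e' with ⟨i, k⟩ | ⟨i, j⟩
    · simp [psi_comm]
    · obtain ⟨h1, h2⟩ := P.tau_comp_mem hn hm hK hKn i j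
      exact ((P.isSupAffine_psi _).auxUpdate_ne_top (h.v_ne_top _) (h.r_ne_top _) hρ
        (h1.trans h2) (hρ.le.trans h1) h2).1
  · have hy : (1 - P.tau K (Sum.inr (i, j))) • P.auxStep s r (Sum.inr (i, j)) =
        P.midY s (Sum.inr (i, j)) - P.tau K (Sum.inr (i, j)) • P.midW s (Sum.inr (i, j)) := by
      rw [auxStep, auxUpdate_smul hρ, ← h.x_eq]
      rfl
    rw [hy, step_x, step_v]
    by_cases he : (Sum.inr (i, j) : Edge n m K) = e
    · subst he
      rw [Function.update_self, P.R_comp hn hK, mul_one]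
      simp only [Pi.add_apply, Pi.smul_apply, Pi.single_eq_same]
      rw [← tau]
      module
    · rw [Function.update_of_ne he]
      simp only [Pi.add_apply, Pi.smul_apply, Pi.single_eq_of_ne he, smul_zero]
      module

lemma mulBlk_pinvProj_comp (hn : 0 < n) (hK : 0 < K) (a : Edge n m K → Vec d) (i : Fin n)
    (j : Fin m) : mulBlk (pinvProj (P.incidence K)) a (Sum.inr (i, j)) = a (Sum.inr (i, j)) := by
  rw [mulBlk, Finset.sum_eq_single (Sum.inr (i, j))]
  · rw [P.pinvProj_comp hn hK, if_pos rfl, one_smul]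
  · intro e _ he
    rw [pinvProj_comm, P.pinvProj_comp hn hK, if_neg he, zero_smul]
  · simp

lemma pinvProj_diag (e : Edge n m K) : pinvProj (P.incidence K) e e = P.R K e :=
  (pinvDiag_eq _ e).symm

/-- The proximal step decreases the distance to any point `ls`, in the form needed for
`accelerated_step`. -/
lemma Admissible.prox_inequality {P : Problem n m d} (h : P.Admissible s r) (hn : 0 < n)
    (hm : 0 < m) (hK : 0 < K) (hKn : K ≤ n) {ls : Edge n m K → Vec d}
    (hls : ∀ e, P.psi K e (ls e) ≠ ⊤) (e : Edge n m K) :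
    inner ℝ (mulBlk (pinvProj (P.incidence K)) (P.midW s - ls) e) (P.proxPoint s e - P.midW s e)
      + pinvProj (P.incidence K) e e * ‖P.proxPoint s e - P.midW s e‖ ^ 2
      + P.rho K / (P.sigmaA K * P.prob K e) * (pinvProj (P.incidence K) e e *
        inner ℝ (mulBlk (P.hessian K) (P.midY s) e) (P.proxPoint s e - P.midW s e)) ≤
    P.rho K / (P.sigmaA K * P.prob K e) * (inner ℝ (mulBlk (P.hessian K) (P.midY s) e)
      (mulBlk (pinvProj (P.incidence K)) (ls - P.midW s) e)
      + ((P.psi K e (ls e)).toReal - (P.psi K e (P.proxPoint s e)).toReal)) := by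
  have hc : 0 < P.rho K / (P.sigmaA K * P.prob K e) :=
    div_pos (P.rho_pos hn hm hK hKn) (mul_pos (P.sigmaA_pos hn hK hKn) (P.prob_pos hn hm hK e))
  have h3 := fun u hu => (three_point (P.isSupAffine_psi e) hc
    (P.proxPoint_spec hn hm hK hKn h.v_ne_top e) (u := u) hu).2
  have hneg : mulBlk (pinvProj (P.incidence K)) (ls - P.midW s) e =
      -mulBlk (pinvProj (P.incidence K)) (P.midW s - ls) e := by
    rw [mulBlk_sub, mulBlk_sub, Pi.sub_apply, Pi.sub_apply, neg_sub]
  rw [hneg]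
  set c := P.rho K / (P.sigmaA K * P.prob K e)
  set g := mulBlk (P.hessian K) (P.midY s) e
  set w := P.midW s e with hw
  set p := P.proxPoint s e with hp
  rcases e with ⟨i, k⟩ | ⟨i, j⟩
  · simp only [psi_comm, EReal.toReal_zero, mul_zero, add_zero, sub_self] at h3 ⊢
    -- With ψ = 0 the three-point inequality at the gradient step forces p = w - c g. The claim is
    -- then an equality, although Q couples the communication blocks.
    have h4 := h3 (w - c • g) (by simp)
    have h5 : p = w - c • g := by
      rw [← sub_eq_zero, ← norm_eq_zero, ← sq_eq_zero_iff]
      refine le_antisymm ?_ (sq_nonneg _)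
      have h6 : ‖p - (w - c • g)‖ ^ 2 = ‖p - w‖ ^ 2 + 2 * (c * inner ℝ g (p - w))
          + c ^ 2 * ‖g‖ ^ 2 := by
        rw [show p - (w - c • g) = (p - w) + c • g by abel, norm_add_sq_real, inner_smul_right,
          norm_smul, mul_pow, Real.norm_eq_abs, sq_abs, real_inner_comm]
      rw [norm_sub_rev (w - c • g) p, sub_sub_cancel_left, norm_neg, norm_smul, mul_pow,
        Real.norm_eq_abs, sq_abs, inner_sub_right, inner_smul_right,
        real_inner_self_eq_norm_sq] at h4
      rw [inner_sub_right] at h6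
      nlinarith
    have h6 : p - w = -(c • g) := by rw [h5]; abel
    rw [h6, norm_neg, norm_smul, mul_pow, Real.norm_eq_abs, sq_abs, inner_neg_right,
      inner_neg_right, inner_neg_right, inner_smul_right, inner_smul_right,
      real_inner_self_eq_norm_sq, real_inner_comm g]
    apply le_of_eq
    ring
  -- Here Q acts as the identity, so the three-point inequality at ls suffices.
  · have h4 := h3 _ (hls _)
    rw [P.mulBlk_pinvProj_comp hn hK, P.pinvProj_comp hn hK, if_pos rfl, Pi.sub_apply, ← hw]
    set l := ls (Sum.inr (i, j))
    have h5 : ‖l - p‖ ^ 2 = ‖l - w‖ ^ 2 + 2 * inner ℝ (w - l) (p - w) + ‖p - w‖ ^ 2 := by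
      rw [show l - p = (l - w) - (p - w) by abel, norm_sub_sq_real, ← neg_sub w l, inner_neg_left,
        norm_neg]
      ring
    rw [h5] at h4
    have h6 : c * inner ℝ g (p - w) = c * inner ℝ g p - c * inner ℝ g w := by
      rw [inner_sub_right, mul_sub]
    have h7 : c * inner ℝ g (-(w - l)) = c * inner ℝ g l - c * inner ℝ g w := by
      rw [neg_sub, inner_sub_right, mul_sub]
    rw [one_mul, one_mul, mul_add, h6, h7]
    linarith

/-- The weighted value of the non-smooth part at block `e`. -/
def psiAvg (s : State n m d K) (r : Edge n m K → Vec d) (e : Edge n m K) : ℝ :=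
  P.tau K e * (P.psi K e (s.v e)).toReal + (1 - P.tau K e) * (P.psi K e (r e)).toReal

/-- The block is drawn with probability p, and p τ = ρ. The expectation is therefore ρ ψ(prox) + (τ
- ρ) ψ(w) + (1 - τ) ψ(r⁺), and the last two terms are bounded by convexity. -/
lemma Admissible.sum_prob_mul_psiAvg_le {P : Problem n m d} (h : P.Admissible s r) (hn : 0 < n)
    (hm : 0 < m) (hK : 0 < K) (hKn : K ≤ n) (e : Edge n m K) :
    ∑ e', P.prob K e' * P.psiAvg (P.step K s e') (P.auxStep s r) e ≤
      (1 - P.rho K) * P.psiAvg s r e + P.rho K * (P.psi K e (P.proxPoint s e)).toReal := by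
  rcases e with ⟨i, k⟩ | ⟨i, j⟩
  · simp [psiAvg, psi_comm]
  · have hρ := P.rho_pos hn hm hK hKn
    obtain ⟨h1, h2⟩ := P.tau_comp_mem hn hm hK hKn i j
    have h3 := (P.isSupAffine_psi _).averaged_add_auxUpdate_le (h.v_ne_top _)
      (h.r_ne_top (Sum.inr (i, j))) hρ h1 h2
    rw [← h.midW_comp hρ] at h3
    have hp := P.prob_pos hn hm hK (Sum.inr (i, j))
    have hτ : P.prob K (Sum.inr (i, j)) * P.tau K (Sum.inr (i, j)) = P.rho K := by
      unfold tau
      field_simp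
    have hsum := P.sum_prob hn hm hK
    rw [← Finset.add_sum_erase _ _ (Finset.mem_univ (Sum.inr (i, j)))] at hsum ⊢
    have h4 : ∀ e' ∈ Finset.univ.erase (Sum.inr (i, j) : Edge n m K),
        P.prob K e' * P.psiAvg (P.step K s e') (P.auxStep s r) (Sum.inr (i, j)) =
        P.prob K e' * (P.tau K (Sum.inr (i, j)) *
          (P.psi K (Sum.inr (i, j)) (P.midW s (Sum.inr (i, j)))).toReal
          + (1 - P.tau K (Sum.inr (i, j))) *
          (P.psi K (Sum.inr (i, j)) (P.auxStep s r (Sum.inr (i, j)))).toReal) := by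
      intro e' he'
      rw [psiAvg, step_v, Function.update_of_ne (Finset.ne_of_mem_erase he').symm]
    rw [Finset.sum_congr rfl h4, ← Finset.sum_mul, ← sub_eq_of_eq_add' hsum.symm]
    unfold psiAvg
    rw [step_v, Function.update_self]
    unfold auxStep
    rw [← hτ] at h3 ⊢
    linarith

/-- The Lyapunov function. -/
def lyapunov (ls : Edge n m K → Vec d) (s : State n m d K) (r : Edge n m K → Vec d) : ℝ :=
  P.sigmaA K / 2 * bilBlk (pinvProj (P.incidence K)) (s.v - ls) (s.v - ls)
    + 1 / 2 * bilBlk (P.hessian K) s.x s.x + ∑ e, P.psiAvg s r e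
    - (1 / 2 * bilBlk (P.hessian K) ls ls + ∑ e, (P.psi K e (ls e)).toReal)

/-- The quadratic estimate contributes -ρ ψ(prox) and the non-smooth one +ρ ψ(prox) for each edge.
These cancel and leave ρ F(ls), which the subtracted constant absorbs. -/
lemma Admissible.sum_prob_mul_lyapunov_le {P : Problem n m d} (h : P.Admissible s r) (hn : 0 < n)
    (hm : 0 < m) (hK : 0 < K) (hKn : K ≤ n) {ls : Edge n m K → Vec d}
    (hls : ∀ e, P.psi K e (ls e) ≠ ⊤) :
    ∑ e, P.prob K e * P.lyapunov ls (P.step K s e) (P.auxStep s r) ≤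
      (1 - P.rho K) * P.lyapunov ls s r := by
  have hρ := P.rho_pos hn hm hK hKn
  have hacc := accelerated_step (Q := pinvProj (P.incidence K)) (x := s.x) (v := s.v)
    (y := P.midY s) (w := P.midW s) (vt := P.proxPoint s) (ls := ls)
    P.hessian_comm (pinvProj_comm (P.incidence K)) P.hessian_mul_pinvProj
    (fun e => by rw [pinvProj_diag]; exact (P.R_pos hn hK e).le)
    P.bilBlk_pinvProj_nonneg (P.sigmaA_mul_bilBlk_le hn) (P.prob_pos hn hm hK)
    (P.sum_prob hn hm hK) (P.sigmaA_pos hn hK hKn) hρ (P.rho_le_one hn hm hK hKn)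
    (fun e => by rw [pinvProj_diag]; exact (P.rho_sq_mul_le hn hK hKn e).2)
    (by rw [midY, smul_inv_smul₀ (by positivity)]) rfl
    (h.prox_inequality hn hm hK hKn hls)
  have hpsi := Finset.sum_le_sum fun e (_ : e ∈ Finset.univ) =>
    h.sum_prob_mul_psiAvg_le hn hm hK hKn e
  rw [Finset.sum_comm, Finset.sum_add_distrib, ← Finset.mul_sum, ← Finset.mul_sum] at hpsi
  rw [Finset.sum_sub_distrib] at hacc
  set F := 1 / 2 * bilBlk (P.hessian K) ls ls + ∑ e, (P.psi K e (ls e)).toReal with hF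
  have hsplit : ∀ e, P.prob K e * P.lyapunov ls (P.step K s e) (P.auxStep s r) =
      P.prob K e * (P.sigmaA K / 2 * bilBlk (pinvProj (P.incidence K))
          (P.midW s + Pi.single e (P.proxPoint s e - P.midW s e) - ls)
          (P.midW s + Pi.single e (P.proxPoint s e - P.midW s e) - ls)
        + 1 / 2 * bilBlk (P.hessian K)
          (P.midY s + (P.rho K * pinvProj (P.incidence K) e e / P.prob K e) •
            (Pi.single e (P.proxPoint s e - P.midW s e) : Edge n m K → Vec d))
          (P.midY s + (P.rho K * pinvProj (P.incidence K) e e / P.prob K e) •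
            (Pi.single e (P.proxPoint s e - P.midW s e) : Edge n m K → Vec d)))
      + ∑ e', P.prob K e * P.psiAvg (P.step K s e) (P.auxStep s r) e' - P.prob K e * F := by
    intro e
    rw [← Finset.mul_sum, lyapunov, step_v, step_x, update_eq_add_single, pinvProj_diag]
    ring
  rw [Finset.sum_congr rfl fun e _ => hsplit e, Finset.sum_sub_distrib, Finset.sum_add_distrib,
    ← Finset.sum_mul, P.sum_prob hn hm hK, one_mul]
  unfold lyapunov
  rw [← hF]
  have hρF : P.rho K * F = P.rho K * (1 / 2 * bilBlk (P.hessian K) ls ls)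
      + P.rho K * ∑ e, (P.psi K e (ls e)).toReal := by rw [hF, mul_add]
  linarith

/-- The remaining part of the Lyapunov function is an upper bound on F(x) - F(λ⋆). It is nonnegative
by convexity of q and the subgradient inequalities at v and r, weighted by τ and 1 - τ so that the
linear terms recombine at x. -/
lemma Admissible.le_lyapunov {P : Problem n m d} (h : P.Admissible s r) (hn : 0 < n)
    (hm : 0 < m) (hK : 0 < K) (hKn : K ≤ n) {θs : Vec d}
    (hθ : IsMinOn P.objective Set.univ θs) :
    P.sigmaA K / 2 * bilBlk (pinvProj (P.incidence K)) (s.v - P.dualOpt K θs)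
      (s.v - P.dualOpt K θs) ≤ P.lyapunov (P.dualOpt K θs) s r := by
  set ls := P.dualOpt K θs with hls
  have hρ := P.rho_pos hn hm hK hKn
  have hq : 1 / 2 * bilBlk (P.hessian K) ls ls + bilBlk (P.hessian K) ls (s.x - ls) ≤
      1 / 2 * bilBlk (P.hessian K) s.x s.x := by
    have h0 : 0 ≤ bilBlk (P.hessian K) (s.x - ls) (s.x - ls) :=
      (mul_nonneg (P.sigmaA_pos hn hK hKn).le (P.bilBlk_pinvProj_nonneg _)).trans
        (P.sigmaA_mul_bilBlk_le hn _)
    simp only [bilBlk_sub_left, bilBlk_sub_right, bilBlk_comm s.x ls P.hessian_comm] at h0 ⊢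
    linarith
  have hpsi : ∀ e, (P.psi K e (ls e)).toReal
      - inner ℝ (mulBlk (P.hessian K) ls e) ((s.x - ls) e) ≤ P.psiAvg s r e := by
    intro e
    obtain ⟨-, hsub⟩ := P.dualOpt_subgradient hn hK hθ e
    have h1 := hsub _ (h.v_ne_top e)
    have h2 := hsub _ (h.r_ne_top e)
    rw [← hls] at h1 h2
    rcases e with ⟨i, k⟩ | ⟨i, j⟩
    · have h0 : mulBlk (P.hessian K) ls (Sum.inl (i, k)) = 0 := by
        rw [mulBlk_hessian]
        simp only [Edge.src, Edge.dst]
        rw [hls, P.applyA_dualOpt_node hn hK, P.applyA_dualOpt_token hn hK hθ]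
        simp [Sig, Vertex.node, Vertex.token]
      simp [psiAvg, psi_comm, h0]
    · obtain ⟨h3, h4⟩ := P.tau_comp_mem hn hm hK hKn i j
      have h5 := mul_le_mul_of_nonneg_left h1 (hρ.le.trans h3)
      have h6 := mul_le_mul_of_nonneg_left h2 (sub_nonneg.2 h4)
      rw [Pi.sub_apply, h.x_eq, psiAvg]
      rw [inner_sub_right] at h5 h6 ⊢
      rw [inner_add_right, inner_smul_right, inner_smul_right]
      linarith
  have hsum := Finset.sum_le_sum fun e (_ : e ∈ Finset.univ) => hpsi e
  rw [Finset.sum_sub_distrib, ← bilBlk] at hsum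
  unfold lyapunov
  linarith

end Problem

/-! ### Lower bound on ρ and cost per unit of progress. -/

namespace Problem

variable {n m d : ℕ} (P : Problem n m d) {K : ℕ}

/-- By Cauchy–Schwarz the squared sum is at most m (m + Σ_j L_{ij} / σ̃) ≤ m² + m κ_s. -/
lemma sum_sqrt_le (hn : 0 < n) (i : Fin n) :
    ∑ j : Fin m, √(1 + P.L i j / P.sigmaT K) ≤ m + √(m * P.kappaS K) := by
  have hk := P.kappaS_pos (K := K) hn
  refine le_of_sq_le_sq ?_ (by positivity)
  have h1 := sq_sum_le_card_mul_sum_sq (s := Finset.univ)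
    (f := fun j : Fin m => √(1 + P.L i j / P.sigmaT K))
  have h2 : ∀ j, √(1 + P.L i j / P.sigmaT K) ^ 2 = 1 + P.L i j / P.sigmaT K := fun j =>
    Real.sq_sqrt (by
      have := div_pos (P.L_pos i j) (P.sigmaT_pos (K := K) hn)
      linarith)
  simp only [h2, Finset.sum_add_distrib, Finset.sum_const, Finset.card_univ, Fintype.card_fin,
    nsmul_eq_mul, mul_one] at h1
  have h3 := P.le_kappaS (K := K) i
  have hm : (0 : ℝ) ≤ m := Nat.cast_nonneg m
  have h4 := Real.sq_sqrt (mul_nonneg hm hk.le)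
  have h5 := mul_nonneg hm (Real.sqrt_nonneg (m * P.kappaS K))
  have h6 := mul_le_mul_of_nonneg_left h3 hm
  nlinarith

/-- On communication edges the bounds on σ_A and R_e give ρ_e² ≥ p_comm² / (8 κ_s n²), which equals
the target square by the choice of p_comm / p_comp. On computation edges p_{ij}² cancels the factor
1 + L_{ij} / σ̃ and (K / (2 σ̃ κ_s)) / α = 1/4, so the bound is independent of j. -/
lemma le_rho (hn : 0 < n) (hm : 0 < m) (hK : 0 < K) (hKn : K ≤ n) :
    P.pComp K / (2 * n * (m + √(m * P.kappaS K))) ≤ P.rho K := by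
  have : Nonempty (Edge n m K) := ⟨Sum.inl (⟨0, hn⟩, ⟨0, hK⟩)⟩
  have hk := P.kappaS_pos (K := K) hn
  have hs := P.sigmaT_pos (K := K) hn
  have hA := P.sigmaA_pos hn hK hKn
  have hAle := P.le_sigmaA hn hK hKn
  have hpc := P.pComp_pos (K := K) hn hm
  have hn' : (0 : ℝ) < n := by exact_mod_cast hn
  have hm' : (0 : ℝ) < m := by exact_mod_cast hm
  have hK' : (0 : ℝ) < K := by exact_mod_cast hK
  have hKn' : (K : ℝ) ≤ n := by exact_mod_cast hKn
  refine le_ciInf fun e => Real.le_sqrt_of_sq_le ?_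
  have hB : 0 < m + √(m * P.kappaS K) := by positivity
  rcases e with ⟨i, k⟩ | ⟨i, j⟩
  · have hR0 := P.R_pos hn hK (Sum.inl (i, k))
    have hR : P.R K (Sum.inl (i, k)) ≤ 2 / K := by
      rw [P.R_comm hn hK]
      have h1 : 1 / (n : ℝ) ≤ 1 / K := one_div_le_one_div_of_le hK' hKn'
      have h2 : 0 < 1 / ((n : ℝ) * K) := by positivity
      have h3 : (2 : ℝ) / K = 1 / K + 1 / K := by ring
      linarith
    simp only [Edge.src, Edge.dst, Vertex.node, Vertex.token, Sig, prob, weight]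
    calc (P.pComp K / (2 * n * (m + √(m * P.kappaS K)))) ^ 2
        = K / (2 * (P.sigmaT K * P.kappaS K)) / ((P.sigmaT K)⁻¹ + (P.sigmaT K)⁻¹)
          * ((P.pComm K / (n * K)) ^ 2 / (1 ^ 2 * (2 / K))) := by
          rw [P.pComm_eq hn hm, div_pow, div_pow, mul_pow (P.pComp K), div_pow,
            Real.sq_sqrt (by positivity)]
          field_simp
          norm_num
      _ ≤ _ := by gcongr
  · have hL := P.L_pos i j
    have hS0 := P.sum_sqrt_pos (K := K) hn hm i
    have hS := P.sum_sqrt_le (K := K) hn i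
    have ha := P.alpha_pos hn hK
    rw [P.R_comp hn hK, P.weight_comp_sq hn hK]
    simp only [Edge.src, Edge.dst, Vertex.node, Vertex.comp, Sig, prob]
    have h1 : 0 < 1 + P.L i j / P.sigmaT K := by positivity
    calc (P.pComp K / (2 * n * (m + √(m * P.kappaS K)))) ^ 2
        ≤ (P.pComp K / (2 * n * ∑ j' : Fin m, √(1 + P.L i j' / P.sigmaT K))) ^ 2 := by gcongr
      _ = K / (2 * (P.sigmaT K * P.kappaS K)) / ((P.L i j)⁻¹ + (P.sigmaT K)⁻¹)
          * ((P.pComp K / n * (√(1 + P.L i j / P.sigmaT K) /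
            ∑ j' : Fin m, √(1 + P.L i j' / P.sigmaT K))) ^ 2 / (P.alpha K * P.L i j * 1)) := by
          rw [mul_pow (P.pComp K / n), div_pow √(1 + P.L i j / P.sigmaT K), Real.sq_sqrt h1.le]
          unfold alpha
          field_simp
      _ ≤ _ := by gcongr

lemma pComp_div_le (hn : 0 < n) (hm : 0 < m) (hK : 0 < K) (hKn : K ≤ n) :
    P.pComp K / n ≤ 2 * (m + √(m * P.kappaS K)) * P.rho K := by
  have hn' : (0 : ℝ) < n := by exact_mod_cast hn
  have hm' : (0 : ℝ) < m := by exact_mod_cast hm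
  have hB : 0 < m + √(m * P.kappaS K) := by positivity
  have h := P.le_rho hn hm hK hKn
  rw [div_le_iff₀ (by positivity)] at h
  rw [div_le_iff₀ hn']
  linarith

lemma pComm_div_le (hn : 0 < n) (hm : 0 < m) (hK : 0 < K) (hKn : K ≤ n) :
    P.pComm K / K ≤ 3 * (n / K * √(P.kappaS K)) * P.rho K := by
  have hn' : (0 : ℝ) < n := by exact_mod_cast hn
  have hm' : (0 : ℝ) < m := by exact_mod_cast hm
  have hK' : (0 : ℝ) < K := by exact_mod_cast hK
  have hρ := P.rho_pos hn hm hK hKn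
  have hB : 0 < m + √(m * P.kappaS K) := by positivity
  have h := P.pComp_div_le hn hm hK hKn
  rw [div_le_iff₀ hn'] at h
  -- The exact constant would be 2√2; it is rounded up to 3.
  have h2 : √(2 : ℝ) ≤ 3 / 2 := by
    rw [Real.sqrt_le_left (by norm_num)]
    norm_num
  rw [P.pComm_eq hn hm, div_le_iff₀ hK', ← mul_div_assoc, div_le_iff₀ hB]
  rw [Real.sqrt_mul (by norm_num)]
  calc P.pComp K * (√2 * √(P.kappaS K))
      ≤ 2 * (m + √(m * P.kappaS K)) * P.rho K * n * (3 / 2 * √(P.kappaS K)) := by gcongr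
    _ = _ := by field_simp

end Problem

/-! ### Expectations along an iteration driven by independent samples. -/

section RandomIteration

open MeasureTheory ProbabilityTheory

variable {E S : Type*}

/-- Iterate `step` from `s₀` along a sequence of inputs. -/
def run (step : S → E → S) (s₀ : S) (ξ : ℕ → E) : ℕ → S
  | 0 => s₀
  | t + 1 => step (run step s₀ ξ t) (ξ t)

lemma run_congr (step : S → E → S) (s₀ : S) {ξ ξ' : ℕ → E} {t : ℕ} (h : ∀ s < t, ξ s = ξ' s) :
    run step s₀ ξ t = run step s₀ ξ' t := by
  induction t with
  | zero => rfl
  | succ t ih => rw [run, run, ih fun s hs => h s (hs.trans t.lt_succ_self), h t t.lt_succ_self]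

/-- The state after t steps depends on the first t samples only, a point of a finite space when E is
finite. This gives measurability and integrability without any σ-algebra on S. The filler e₀ at
later indices is never read. -/
lemma exists_run_eq_comp [Nonempty E] (step : S → E → S) (s₀ : S) (t : ℕ) :
    ∃ F : (Finset.range t → E) → S, ∀ ξ : ℕ → E,
      run step s₀ ξ t = F fun i => ξ i := by
  obtain ⟨e₀⟩ := ‹Nonempty E›
  refine ⟨fun a => run step s₀
    (fun s => if h : s ∈ Finset.range t then a ⟨s, h⟩ else e₀) t, fun ξ => ?_⟩
  refine run_congr step s₀ fun s hs => ?_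
  rw [dif_pos (Finset.mem_range.2 hs)]

variable [Fintype E] [MeasurableSpace E] [MeasurableSingletonClass E]
  {Ω : Type*} [MeasurableSpace Ω] {μ : Measure Ω} [IsProbabilityMeasure μ] {ξ : ℕ → Ω → E}

lemma integrable_run [Nonempty E] (hmeas : ∀ t, Measurable (ξ t)) (step : S → E → S) (s₀ : S)
    (G : S → ℝ) (t : ℕ) : Integrable (fun ω => G (run step s₀ (fun s => ξ s ω) t)) μ := by
  obtain ⟨F, hF⟩ := exists_run_eq_comp step s₀ t
  have hX : Measurable fun ω (i : Finset.range t) => ξ i ω :=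
    measurable_pi_lambda _ fun i => hmeas i
  have : Integrable (G ∘ F) (μ.map fun ω (i : Finset.range t) => ξ i ω) := by
    have := Measure.isProbabilityMeasure_map (μ := μ) hX.aemeasurable
    exact Integrable.of_finite
  refine (this.comp_measurable hX).congr (Filter.Eventually.of_forall fun ω => ?_)
  simp only [Function.comp, hF]

/-- The next state is split according to the value of ξ t, which is independent of the earlier
samples and hence of the current state. -/
lemma integral_run_succ [Nonempty E] (hmeas : ∀ t, Measurable (ξ t)) (hind : iIndepFun ξ μ)
    {p : E → ℝ} (hlaw : ∀ t e, μ.real {ω | ξ t ω = e} = p e) (step : S → E → S) (s₀ : S)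
    (G : S → ℝ) (t : ℕ) :
    ∫ ω, G (run step s₀ (fun s => ξ s ω) (t + 1)) ∂μ =
      ∫ ω, ∑ e, p e * G (step (run step s₀ (fun s => ξ s ω) t) e) ∂μ := by
  classical
  obtain ⟨F, hF⟩ := exists_run_eq_comp step s₀ t
  have hint : ∀ e, Integrable (fun ω => G (step (run step s₀ (fun s => ξ s ω) t) e)) μ :=
    fun e => integrable_run hmeas step s₀ (fun s => G (step s e)) t
  have hindt : IndepFun (fun ω (i : Finset.range t) => ξ i ω) (ξ t) μ := by
    have h := hind.indepFun_finset (Finset.range t) {t} (by simp) hmeas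
    exact h.comp measurable_id
      (measurable_pi_apply (⟨t, Finset.mem_singleton_self t⟩ : ({t} : Finset ℕ)))
  have hdecomp : ∀ ω, G (run step s₀ (fun s => ξ s ω) (t + 1)) =
      ∑ e, G (step (run step s₀ (fun s => ξ s ω) t) e) * (if ξ t ω = e then 1 else 0) := by
    intro ω
    simp [run]
  have hmul : ∀ e, ∫ ω, G (step (run step s₀ (fun s => ξ s ω) t) e)
        * (if ξ t ω = e then 1 else 0) ∂μ =
      (∫ ω, G (step (run step s₀ (fun s => ξ s ω) t) e) ∂μ) * p e := by
    intro e
    have hi : IndepFun (fun ω => G (step (run step s₀ (fun s => ξ s ω) t) e))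
        (fun ω => if ξ t ω = e then (1 : ℝ) else 0) μ := by
      have := hindt.comp (φ := fun a => G (step (F a) e))
        (ψ := fun e' => if e' = e then (1 : ℝ) else 0)
        (measurable_of_finite _) (measurable_of_finite _)
      refine this.congr (Filter.Eventually.of_forall fun ω => ?_) (Filter.Eventually.of_forall
        fun ω => rfl)
      simp only [Function.comp, hF]
    have hset : MeasurableSet {ω | ξ t ω = e} := hmeas t (measurableSet_singleton e)
    rw [hi.integral_fun_mul_eq_mul_integral (hint e).aestronglyMeasurable
      ((measurable_const.ite hset measurable_const).aestronglyMeasurable)]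
    congr 1
    rw [← hlaw t e, ← integral_indicator_one hset]
    refine integral_congr_ae (Filter.Eventually.of_forall fun ω => ?_)
    simp [Set.indicator_apply]
  have hint2 : ∀ e, Integrable (fun ω => G (step (run step s₀ (fun s => ξ s ω) t) e)
        * (if ξ t ω = e then 1 else 0)) μ := by
    intro e
    have hset : MeasurableSet {ω | ξ t ω = e} := hmeas t (measurableSet_singleton e)
    refine ((hint e).indicator hset).congr (Filter.Eventually.of_forall fun ω => ?_)
    simp [Set.indicator_apply]
  rw [integral_congr_ae (Filter.Eventually.of_forall hdecomp),
    integral_finsetSum _ fun e _ => hint2 e, integral_finsetSum _ fun e _ => (hint e).const_mul _]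
  refine Finset.sum_congr rfl fun e _ => ?_
  rw [hmul, integral_const_mul, mul_comm]

/-- Geometric decrease of the expectation of a function that decreases in conditional expectation
along an invariant. -/
lemma integral_run_le_pow [Nonempty E] (hmeas : ∀ t, Measurable (ξ t)) (hind : iIndepFun ξ μ)
    {p : E → ℝ} (hlaw : ∀ t e, μ.real {ω | ξ t ω = e} = p e) {step : S → E → S} {s₀ : S}
    {G : S → ℝ} {I : S → Prop} (h0 : I s₀) (hI : ∀ s e, I s → I (step s e)) {q : ℝ} (hq : 0 ≤ q)
    (hG : ∀ s, I s → ∑ e, p e * G (step s e) ≤ q * G s) (t : ℕ) :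
    ∫ ω, G (run step s₀ (fun s => ξ s ω) t) ∂μ ≤ q ^ t * G s₀ := by
  have hinv : ∀ (ζ : ℕ → E) t, I (run step s₀ ζ t) := by
    intro ζ t
    induction t with
    | zero => exact h0
    | succ t ih => exact hI _ _ ih
  induction t with
  | zero => simp [run]
  | succ t ih =>
    rw [integral_run_succ hmeas hind hlaw]
    calc ∫ ω, ∑ e, p e * G (step (run step s₀ (fun s => ξ s ω) t) e) ∂μ
        ≤ ∫ ω, q * G (run step s₀ (fun s => ξ s ω) t) ∂μ := by
          refine integral_mono ?_ ((integrable_run hmeas step s₀ G t).const_mul q)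
            fun ω => hG _ (hinv _ t)
          exact integrable_run hmeas step s₀ (fun s => ∑ e, p e * G (step s e)) t
      _ = q * ∫ ω, G (run step s₀ (fun s => ξ s ω) t) ∂μ := integral_const_mul _ _
      _ ≤ q * (q ^ t * G s₀) := by gcongr
      _ = q ^ (t + 1) * G s₀ := by ring

lemma integral_comp_sample [Nonempty E] (hmeas : ∀ t, Measurable (ξ t)) (hind : iIndepFun ξ μ)
    {p : E → ℝ} (hlaw : ∀ t e, μ.real {ω | ξ t ω = e} = p e) (g : E → ℝ) (t : ℕ) :
    Integrable (fun ω => g (ξ t ω)) μ ∧ ∫ ω, g (ξ t ω) ∂μ = ∑ e, p e * g e := by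
  obtain ⟨e₀⟩ := ‹Nonempty E›
  have : Nonempty E := ⟨e₀⟩
  refine ⟨integrable_run hmeas (fun _ e => e) e₀ g (t + 1), ?_⟩
  -- For the iteration that only remembers its last input, the state at time t + 1 is ξ t.
  have h := integral_run_succ hmeas hind hlaw (fun _ e => e) e₀ g t
  simpa [run] using h

/-- The expected number of samples in a set during the first `T` draws. -/
lemma integral_card_filter [Nonempty E] (hmeas : ∀ t, Measurable (ξ t)) (hind : iIndepFun ξ μ)
    {p : E → ℝ} (hlaw : ∀ t e, μ.real {ω | ξ t ω = e} = p e) (b : E → Bool) (T : ℕ) :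
    ∫ ω, (((Finset.range T).filter fun t => b (ξ t ω) = true).card : ℝ) ∂μ =
      T * ∑ e, p e * (if b e = true then 1 else 0) := by
  have h := integral_comp_sample hmeas hind hlaw fun e => if b e = true then (1 : ℝ) else 0
  simp only [Finset.card_filter, Nat.cast_sum, Nat.cast_ite, Nat.cast_one, Nat.cast_zero]
  rw [integral_finsetSum _ fun t _ => (h t).1, Finset.sum_congr rfl fun t _ => (h t).2]
  simp

end RandomIteration

/-! ### Convergence of the tokens and expected numbers of steps. -/

open MeasureTheory ProbabilityTheory

instance Edge.instMeasurableSingletonClass {n m K : ℕ} :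
    MeasurableSingletonClass (Edge n m K) where
  measurableSet_singleton _ :=
    measurableSet_sum_iff.2 ⟨(Set.toFinite _).measurableSet, (Set.toFinite _).measurableSet⟩

namespace Problem

variable {n m d : ℕ} (P : Problem n m d) {K : ℕ}

variable (K) in
/-- One step of the iterates together with their auxiliary points. -/
def augStep (z : State n m d K × (Edge n m K → Vec d)) (e : Edge n m K) :
    State n m d K × (Edge n m K → Vec d) :=
  (P.step K z.1 e, P.auxStep z.1 z.2)

variable (K) in
/-- The initial iterates together with their auxiliary points. -/
def augInit (u : Fin n → Fin m → Vec d) : State n m d K × (Edge n m K → Vec d) :=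
  ({ x := P.initDual K u, v := P.initDual K u }, P.initDual K u)

lemma run_augStep_fst (u : Fin n → Fin m → Vec d) (ξ : ℕ → Edge n m K) (t : ℕ) :
    (run (P.augStep K) (P.augInit K u) ξ t).1 = P.iter K u ξ t := by
  induction t with
  | zero => rfl
  | succ t ih => rw [run, augStep, ih]; rfl

lemma admissible_augInit (hn : 0 < n) (hK : 0 < K) {u : Fin n → Fin m → Vec d}
    (hu : ∀ i j, conj (P.f i j) (u i j) ≠ ⊤) :
    P.Admissible (P.augInit K u).1 (P.augInit K u).2 := by
  have h : ∀ e, P.psi K e (P.initDual K u e) ≠ ⊤ := by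
    rintro (⟨i, k⟩ | ⟨i, j⟩)
    · simp [psi_comm]
    · simp only [psi, initDual]
      rw [smul_inv_smul₀ (P.weight_pos hn hK _).ne']
      have := hu i j
      revert this
      generalize conj (P.f i j) (u i j) = c
      intro hc
      induction c with
      | bot => simp
      | top => exact absurd rfl hc
      | coe c => rw [← EReal.coe_sub]; exact EReal.coe_ne_top _
  refine ⟨h, h, fun i j => ?_⟩
  simp only [augInit]
  module

lemma integral_lyapunov_le (hn : 0 < n) (hm : 0 < m) (hK : 0 < K) (hKn : K ≤ n)
    {u : Fin n → Fin m → Vec d} (hu : ∀ i j, conj (P.f i j) (u i j) ≠ ⊤) {θs : Vec d}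
    (hθ : IsMinOn P.objective Set.univ θs) {Ω : Type*} [MeasurableSpace Ω] {μ : Measure Ω}
    [IsProbabilityMeasure μ] {ξ : ℕ → Ω → Edge n m K} (hξ : P.IsSampling K μ ξ) (t : ℕ) :
    ∫ ω, bilBlk (pinvProj (P.incidence K)) ((P.iter K u (fun s => ξ s ω) t).v - P.dualOpt K θs)
        ((P.iter K u (fun s => ξ s ω) t).v - P.dualOpt K θs) ∂μ ≤
      2 / P.sigmaA K * ((1 - P.rho K) ^ t *
        P.lyapunov (P.dualOpt K θs) (P.augInit K u).1 (P.augInit K u).2) := by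
  have : Nonempty (Edge n m K) := ⟨Sum.inl (⟨0, hn⟩, ⟨0, hK⟩)⟩
  have hA := P.sigmaA_pos hn hK hKn
  have h0 := P.admissible_augInit hn hK hu
  have hI : ∀ (z : State n m d K × (Edge n m K → Vec d)) (e : Edge n m K),
      P.Admissible z.1 z.2 → P.Admissible (P.augStep K z e).1 (P.augStep K z e).2 :=
    fun z e hz => hz.step hn hm hK hKn e
  have hinv : ∀ (ζ : ℕ → Edge n m K) t, P.Admissible (run (P.augStep K) (P.augInit K u) ζ t).1
      (run (P.augStep K) (P.augInit K u) ζ t).2 := by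
    intro ζ t
    induction t with
    | zero => exact h0
    | succ t ih => exact hI _ _ ih
  have hmain := integral_run_le_pow hξ.measurable hξ.indep hξ.law (step := P.augStep K)
    (s₀ := P.augInit K u) (G := fun z => P.lyapunov (P.dualOpt K θs) z.1 z.2)
    (I := fun z => P.Admissible z.1 z.2) h0 hI
    (sub_nonneg.2 (P.rho_le_one hn hm hK hKn))
    (fun z hz => hz.sum_prob_mul_lyapunov_le hn hm hK hKn
      fun e => (P.dualOpt_subgradient hn hK hθ e).1) t
  rw [div_mul_eq_mul_div, le_div_iff₀ hA]
  have hle : ∫ ω, P.sigmaA K / 2 * bilBlk (pinvProj (P.incidence K))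
      ((P.iter K u (fun s => ξ s ω) t).v - P.dualOpt K θs)
      ((P.iter K u (fun s => ξ s ω) t).v - P.dualOpt K θs) ∂μ ≤
      ∫ ω, P.lyapunov (P.dualOpt K θs)
        (run (P.augStep K) (P.augInit K u) (fun s => ξ s ω) t).1
        (run (P.augStep K) (P.augInit K u) (fun s => ξ s ω) t).2 ∂μ := by
    simp only [← run_augStep_fst]
    refine integral_mono ?_ ?_ fun ω => (hinv _ t).le_lyapunov hn hm hK hKn hθ
    · exact integrable_run hξ.measurable (P.augStep K) (P.augInit K u)
        (fun z => P.sigmaA K / 2 * bilBlk (pinvProj (P.incidence K)) (z.1.v - P.dualOpt K θs)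
          (z.1.v - P.dualOpt K θs)) t
    · exact integrable_run hξ.measurable (P.augStep K) (P.augInit K u)
        (fun z => P.lyapunov (P.dualOpt K θs) z.1 z.2) t
  rw [integral_const_mul] at hle
  linarith

lemma tokenParam_sub_sq_le (hn : 0 < n) (hK : 0 < K) {u : Fin n → Fin m → Vec d} {θs : Vec d}
    (hθ : IsMinOn P.objective Set.univ θs) (ξ : ℕ → Edge n m K) (t : ℕ) (k : Fin K) :
    ‖P.tokenParam K u ξ t k - θs‖ ^ 2 ≤
      (P.sigmaT K)⁻¹ ^ 2 * (∑ v, ∑ e, P.incidence K v e ^ 2) *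
        bilBlk (pinvProj (P.incidence K)) ((P.iter K u ξ t).v - P.dualOpt K θs)
          ((P.iter K u ξ t).v - P.dualOpt K θs) := by
  have h1 : P.tokenParam K u ξ t k - θs = (P.sigmaT K)⁻¹ •
      P.applyA K ((P.iter K u ξ t).v - P.dualOpt K θs) (Vertex.token k) := by
    have h2 : P.applyA K ((P.iter K u ξ t).v - P.dualOpt K θs) (Vertex.token k) =
        P.applyA K (P.iter K u ξ t).v (Vertex.token k)
          - P.applyA K (P.dualOpt K θs) (Vertex.token k) := by
      simp [applyA, smul_sub]
    rw [h2, P.applyA_dualOpt_token hn hK hθ, smul_sub, inv_smul_smul₀ (P.sigmaT_pos hn).ne']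
    rfl
  rw [h1, norm_smul, mul_pow, Real.norm_eq_abs, sq_abs, mul_assoc]
  refine mul_le_mul_of_nonneg_left ((P.norm_applyA_sq_le _ _).trans ?_) (sq_nonneg _)
  refine mul_le_mul_of_nonneg_right ?_ (P.bilBlk_pinvProj_nonneg _)
  exact Finset.single_le_sum (f := fun v => ∑ e, P.incidence K v e ^ 2)
    (fun v _ => Finset.sum_nonneg fun e _ => sq_nonneg _) (Finset.mem_univ _)

/-- Linear convergence of the token parameters. -/
lemma exists_tokenParam_bound (hn : 0 < n) (hm : 0 < m) (hK : 0 < K) (hKn : K ≤ n)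
    {u : Fin n → Fin m → Vec d} (hu : ∀ i j, conj (P.f i j) (u i j) ≠ ⊤) {θs : Vec d}
    (hθ : IsMinOn P.objective Set.univ θs) :
    ∃ C₀ : ℝ, 0 < C₀ ∧ ∀ (Ω : Type*) [MeasurableSpace Ω] (μ : Measure Ω)
      [IsProbabilityMeasure μ] (ξ : ℕ → Ω → Edge n m K), P.IsSampling K μ ξ → ∀ t (k : Fin K),
      Integrable (fun ω => ‖P.tokenParam K u (fun s => ξ s ω) t k - θs‖ ^ 2) μ ∧
      ∫ ω, ‖P.tokenParam K u (fun s => ξ s ω) t k - θs‖ ^ 2 ∂μ ≤ C₀ * (1 - P.rho K) ^ t := by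
  have : Nonempty (Edge n m K) := ⟨Sum.inl (⟨0, hn⟩, ⟨0, hK⟩)⟩
  set D := (P.sigmaT K)⁻¹ ^ 2 * (∑ v, ∑ e, P.incidence K v e ^ 2) with hD
  have hD0 : 0 ≤ D := mul_nonneg (sq_nonneg _)
    (Finset.sum_nonneg fun v _ => Finset.sum_nonneg fun e _ => sq_nonneg _)
  have hA := P.sigmaA_pos hn hK hKn
  set Φ := P.lyapunov (P.dualOpt K θs) (P.augInit K u).1 (P.augInit K u).2 with hΦ
  have hΦ0 : 0 ≤ Φ := le_trans (mul_nonneg (half_pos hA).le (P.bilBlk_pinvProj_nonneg _))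
    ((P.admissible_augInit hn hK hu).le_lyapunov hn hm hK hKn hθ)
  -- The summand 1 only ensures strict positivity, since D Φ may vanish.
  refine ⟨D * (2 / P.sigmaA K * Φ) + 1, by positivity, ?_⟩
  intro Ω _ μ _ ξ hξ t k
  have hint : Integrable (fun ω => ‖P.tokenParam K u (fun s => ξ s ω) t k - θs‖ ^ 2) μ := by
    have := integrable_run (μ := μ) hξ.measurable (P.augStep K) (P.augInit K u)
      (fun z => ‖(P.sigmaT K)⁻¹ • P.applyA K z.1.v (Vertex.token k) - θs‖ ^ 2) t
    simp only [run_augStep_fst] at this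
    exact this
  refine ⟨hint, ?_⟩
  have hint2 : Integrable (fun ω => D * bilBlk (pinvProj (P.incidence K))
      ((P.iter K u (fun s => ξ s ω) t).v - P.dualOpt K θs)
      ((P.iter K u (fun s => ξ s ω) t).v - P.dualOpt K θs)) μ := by
    have := integrable_run (μ := μ) hξ.measurable (P.augStep K) (P.augInit K u)
      (fun z => D * bilBlk (pinvProj (P.incidence K)) (z.1.v - P.dualOpt K θs)
        (z.1.v - P.dualOpt K θs)) t
    simpa only [run_augStep_fst] using this
  have h1 := integral_mono hint hint2 fun ω =>
    P.tokenParam_sub_sq_le hn hK hθ (fun s => ξ s ω) t k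
  rw [integral_const_mul] at h1
  have h2 := mul_le_mul_of_nonneg_left (P.integral_lyapunov_le hn hm hK hKn hu hθ hξ t) hD0
  have h3 : 0 ≤ (1 - P.rho K) ^ t := pow_nonneg (sub_nonneg.2 (P.rho_le_one hn hm hK hKn)) t
  refine h1.trans (h2.trans ?_)
  rw [add_mul, one_mul]
  refine le_trans (le_of_eq ?_) (le_add_of_nonneg_right h3)
  ring

lemma integral_compCount (hn : 0 < n) (hm : 0 < m) (hK : 0 < K) {Ω : Type*} [MeasurableSpace Ω]
    {μ : Measure Ω} [IsProbabilityMeasure μ] {ξ : ℕ → Ω → Edge n m K} (hξ : P.IsSampling K μ ξ)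
    (T : ℕ) (i : Fin n) :
    ∫ ω, (compCount (fun s => ξ s ω) T i : ℝ) ∂μ = T * (P.pComp K / n) := by
  have : Nonempty (Edge n m K) := ⟨Sum.inl (⟨0, hn⟩, ⟨0, hK⟩)⟩
  have h := integral_card_filter hξ.measurable hξ.indep hξ.law (Edge.isCompOf i) T
  refine h.trans ?_
  rw [← P.sum_prob_comp hn hm i, Fintype.sum_sum_type, Fintype.sum_prod_type,
    Fintype.sum_prod_type]
  simp only [Edge.isCompOf]
  simp [Finset.sum_ite_irrel]

lemma integral_jumpCount (hn : 0 < n) (hK : 0 < K) {Ω : Type*} [MeasurableSpace Ω]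
    {μ : Measure Ω} [IsProbabilityMeasure μ] {ξ : ℕ → Ω → Edge n m K} (hξ : P.IsSampling K μ ξ)
    (T : ℕ) (k : Fin K) :
    ∫ ω, (jumpCount (fun s => ξ s ω) T k : ℝ) ∂μ = T * (P.pComm K / K) := by
  have : Nonempty (Edge n m K) := ⟨Sum.inl (⟨0, hn⟩, ⟨0, hK⟩)⟩
  have hn' : (n : ℝ) ≠ 0 := by exact_mod_cast hn.ne'
  have h := integral_card_filter hξ.measurable hξ.indep hξ.law (Edge.isJumpOf k) T
  refine h.trans ?_
  rw [Fintype.sum_sum_type, Fintype.sum_prod_type]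
  simp only [Edge.isJumpOf]
  simp [prob]
  field_simp
  simp

end Problem

/-- The number of steps after which a linearly convergent quantity is below `ε`. -/
lemma exists_iteration_count {ρ C₀ : ℝ} (hρ0 : 0 < ρ) (hρ1 : ρ ≤ 1) (hC : 0 < C₀) {ε : ℝ}
    (hε : 0 < ε) : ∃ T : ℕ, (∀ t, T ≤ t → C₀ * (1 - ρ) ^ t ≤ ε) ∧
      ρ * T ≤ 3 * Real.log (1 + C₀ / ε) := by
  have hlog0 : 0 ≤ Real.log (1 + C₀ / ε) := Real.log_nonneg (by
    have : 0 < C₀ / ε := by positivity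
    linarith)
  by_cases h : C₀ ≤ ε
  · refine ⟨0, fun t _ => le_trans ?_ h, by simpa using hlog0⟩
    exact mul_le_of_le_one_right hC.le (pow_le_one₀ (by linarith) (by linarith))
  · rw [not_le] at h
    have hone : 1 < C₀ / ε := (one_lt_div hε).2 h
    have hl0 : 0 < Real.log (C₀ / ε) := Real.log_pos hone
    refine ⟨⌈Real.log (C₀ / ε) / ρ⌉₊, fun t ht => ?_, ?_⟩
    · have h1 : Real.log (C₀ / ε) ≤ ρ * t := by
        have := (Nat.le_ceil _).trans (Nat.cast_le (α := ℝ).2 ht)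
        rwa [div_le_iff₀ hρ0, mul_comm] at this
      have h2 : (1 - ρ) ^ t ≤ Real.exp (-(ρ * t)) := by
        have h3 := Real.add_one_le_exp (-ρ)
        calc (1 - ρ) ^ t ≤ Real.exp (-ρ) ^ t := pow_le_pow_left₀ (by linarith) (by linarith) t
          _ = Real.exp (-(ρ * t)) := by rw [← Real.exp_nat_mul]; congr 1; ring
      have h4 : Real.exp (-(ρ * t)) ≤ Real.exp (-Real.log (C₀ / ε)) :=
        Real.exp_le_exp.2 (neg_le_neg h1)
      rw [Real.exp_neg (Real.log _), Real.exp_log (by positivity), inv_div] at h4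
      calc C₀ * (1 - ρ) ^ t ≤ C₀ * (ε / C₀) := by gcongr; exact h2.trans h4
        _ = ε := by field_simp
    · have h1 := (Nat.ceil_lt_add_one (div_nonneg hl0.le hρ0.le)).le
      have h2 : ρ * (⌈Real.log (C₀ / ε) / ρ⌉₊ : ℝ) ≤ Real.log (C₀ / ε) + ρ := by
        refine (mul_le_mul_of_nonneg_left h1 hρ0.le).trans_eq ?_
        field_simp
      have h3 : Real.log (C₀ / ε) ≤ Real.log (1 + C₀ / ε) :=
        Real.log_le_log (by positivity) (by linarith)
      -- Rounding up costs ρ ≤ 1 ≤ 2 log 2, and C₀/ε > 1 turns this into at most 2 log(1 + C₀/ε);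
      -- hence the factor 3.
      have h4 : Real.log 2 ≤ Real.log (1 + C₀ / ε) := Real.log_le_log (by norm_num) (by linarith)
      have h5 := Real.log_two_gt_d9
      linarith

end TAVR

end

theorem theorem4 :
    ∃ C : ℝ, 0 < C ∧
      ∀ (n m d K : ℕ), 1 ≤ m → 1 ≤ K → K ≤ n →
      ∀ (P : TAVR.Problem n m d) (u : Fin n → Fin m → TAVR.Vec d),
        (∀ i j, TAVR.conj (P.f i j) (u i j) ≠ ⊤) →
      ∀ θs : TAVR.Vec d, IsMinOn P.objective Set.univ θs →
      ∃ C₀ : ℝ, 0 < C₀ ∧ ∀ ε : ℝ, 0 < ε → ∃ T : ℕ,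
        ∀ (Ω : Type*) [MeasurableSpace Ω] (μ : MeasureTheory.Measure Ω)
          [MeasureTheory.IsProbabilityMeasure μ] (ξ : ℕ → Ω → TAVR.Edge n m K),
          P.IsSampling K μ ξ →
          (∀ t, T ≤ t → ∀ k : Fin K,
            MeasureTheory.Integrable
              (fun ω => ‖P.tokenParam K u (fun s => ξ s ω) t k - θs‖ ^ 2) μ ∧
            ∫ ω, ‖P.tokenParam K u (fun s => ξ s ω) t k - θs‖ ^ 2 ∂μ ≤ ε) ∧
          (∀ i : Fin n,
            ∫ ω, (TAVR.compCount (fun s => ξ s ω) T i : ℝ) ∂μ ≤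
              C * (m + √(m * P.kappaS K)) * Real.log (1 + C₀ / ε)) ∧
          (∀ k : Fin K,
            ∫ ω, (TAVR.jumpCount (fun s => ξ s ω) T k : ℝ) ∂μ ≤
              C * (n / K * √(P.kappaS K)) * Real.log (1 + C₀ / ε)) := by
  -- Since ρ T ≤ 3 log(1 + C₀/ε), the computation cost has constant 2 · 3 = 6 and the communication
  -- cost 3 · 3 = 9.
  refine ⟨9, by norm_num, ?_⟩
  intro n m d K hm hK hKn P u hu θs hθ
  have hn : 0 < n := lt_of_lt_of_le hK hKn
  obtain ⟨C₀, hC₀, hbound⟩ := P.exists_tokenParam_bound hn hm hK hKn hu hθ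
  refine ⟨C₀, hC₀, fun ε hε => ?_⟩
  obtain ⟨T, hT, hTρ⟩ := TAVR.exists_iteration_count (P.rho_pos hn hm hK hKn)
    (P.rho_le_one hn hm hK hKn) hC₀ hε
  refine ⟨T, fun Ω _ μ _ ξ hξ => ⟨fun t ht k => ?_, fun i => ?_, fun k => ?_⟩⟩
  · obtain ⟨h1, h2⟩ := hbound Ω μ ξ hξ t k
    exact ⟨h1, h2.trans (hT t ht)⟩
  · rw [P.integral_compCount hn hm hK hξ]
    have hB : (0 : ℝ) ≤ m + √(m * P.kappaS K) := by positivity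
    have h1 := mul_le_mul_of_nonneg_left (P.pComp_div_le hn hm hK hKn) (Nat.cast_nonneg (α := ℝ) T)
    have h2 := mul_le_mul_of_nonneg_left hTρ hB
    have h3 : 0 ≤ (m + √(m * P.kappaS K)) * (P.rho K * T) :=
      mul_nonneg hB (mul_nonneg (P.rho_pos hn hm hK hKn).le (Nat.cast_nonneg T))
    linarith
  · rw [P.integral_jumpCount hn hK hξ]
    have hB : (0 : ℝ) ≤ n / K * √(P.kappaS K) := by positivity
    have h1 := mul_le_mul_of_nonneg_left (P.pComm_div_le hn hm hK hKn) (Nat.cast_nonneg (α := ℝ) T)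
    have h2 := mul_le_mul_of_nonneg_left hTρ hB
    linarith
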